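/- **Setting.** Let $\mathcal H_{A_1},\dots,\mathcal H_{A_n}$ be separable complex Hilbert spaces, $\mathcal H=\mathcal H_{A_1}\otimes\cdots\otimes\mathcal H_{A_n}$, $m\le n$, and let $\mathfrak S(\mathcal H)$ be the set of states (positive trace-class operators of unit trace) on $\mathcal H$. For a positive trace-class operator $\varrho$ on $\mathcal H$ let $\varrho_{A_k}$ be its partial trace over all factors but the $k$-th. Let $S(\omega)=\operatorname{Tr}\eta(\omega)\in[0,\infty]$, $\eta(x)=-x\ln x$, be the von Neumann entropy, $C_m(\varrho)=\sum_{k=1}^m S(\varrho_{A_k})$, and $h(p)=\eta(p)+\eta(1-p)$. Let $h^{\uparrow}(x)=h(x)$ for $x\in[0,\frac12]$ and $h^{\uparrow}(x)=\ln 2$ for $x\in(\frac12,1]$; for a function $g$ on $[0,1]$ let $\{g(\varepsilon)\}^{\uparrow}_\varepsilon=\sup_{t\in[0,\varepsilon]}g(t)$. Conventions: $0\cdot\infty=0$ and, in the bounds below, $\ln 0=0$ (this matters only when $\rho=\sigma$). Let $\mathfrak S_0\subseteq\mathfrak S(\mathcal H)$ be convex and such that $\varsigma\in\mathfrak S_0$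 whenever $\varrho\in\mathfrak S_0$, $\varsigma\in\mathfrak S(\mathcal H)$, $c\,\varsigma\le\varrho$ for some $c>0$, and $[\varrho,\varsigma]=0$. The class $L_n^m(C,D\,|\,\mathfrak S_0)$ consists of all functions $f:\mathfrak S_0\to(-\infty,+\infty]$ for which there are $c^\pm,d^\pm\ge 0$ with $c^-+c^+=C$, $d^-+d^+=D$ such that $$-c^-C_m(\rho)\le f(\rho)\le c^+C_m(\rho),$$ $$pf(\rho)+(1-p)f(\sigma)-d^-h(p)\le f(p\rho+(1-p)\sigma)\le pf(\rho)+(1-p)f(\sigma)+d^+h(p)$$ for all $\rho,\sigma\in\mathfrak S_0$ and $p\in[0,1]$ (infinite values are allowed). The class $\widehat L_n^m(C,D\,|\,\mathfrak S_0)$ consists of these functions and of all pointwise infima $\inf_\lambda f_\lambda$ and suprema $\sup_\lambda f_\lambda$ of nonempty families $\{f_\lambda\}$ in $L_n^m(C,D\,|\,\mathfrak S_0)$. **A)** Let $f\in\widehat L_n^m(C,D\,|\,\mathfrak S_0)$ and let $\rho,\sigma\in\mathfrak S_0$ be commuting states such that $d_m(\rho,\sigma)=\max\{\prod_{k=1}^m\operatorname{rank}\rho_{A_k},\prod_{k=1}^m\operatorname{rank}\sigma_{A_k}\}$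 is finite. Then $f(\rho)$, $f(\sigma)$ are finite, and if $\frac12\|\rho-\sigma\|_1=\varepsilon$, then $$|f(\rho)-f(\sigma)|\le C\varepsilon\ln d_m(\rho,\sigma)+Dh(\varepsilon).$$ If only $\frac12\|\rho-\sigma\|_1\le\varepsilon\le1$, then the same holds with the right-hand side replaced by either of $\{C\varepsilon\ln d_m(\rho,\sigma)+Dh(\varepsilon)\}^{\uparrow}_\varepsilon$ and $C\varepsilon\ln d_m(\rho,\sigma)+Dh^{\uparrow}(\varepsilon)$. If $m=n=1$, then in all three bounds $d_m(\rho,\sigma)$ can be replaced by $d_*(\rho,\sigma)-1$, where $d_*(\rho,\sigma)$ is the (finite) dimension of the minimal subspace containing the supports of $\rho$ and $\sigma$. **B)** Let $f$ be a nonnegative function in $L_n^m(C,D\,|\,\mathfrak S_0)$, or the infimum or the supremum of a nonempty family of nonnegative functions in $L_n^m(C,D\,|\,\mathfrak S_0)$. Let $\rho\in\mathfrak S_0$ be such that $d_m(\rho)=\prod_{k=1}^m\operatorname{rank}\rho_{A_k}$ is finite. Then $f(\rho)$ is finite, and for every $\sigma\in\mathfrak S_0$ with $[\rho,\sigma]=0$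 and $\frac12\|\rho-\sigma\|_1=\varepsilon$, $$f(\rho)-f(\sigma)\le C\varepsilon\ln d_m(\rho)+Dh(\varepsilon)$$ (the left-hand side may be $-\infty$). If only $\frac12\|\rho-\sigma\|_1\le\varepsilon\le1$, then the same holds with the right-hand side replaced by either of $\{C\varepsilon\ln d_m(\rho)+Dh(\varepsilon)\}^{\uparrow}_\varepsilon$ and $C\varepsilon\ln d_m(\rho)+Dh^{\uparrow}(\varepsilon)$. In all three bounds $d_m(\rho)$ can be replaced by the (finite) number $d_m^*(\rho,\sigma)=\prod_{k=1}^m\operatorname{rank}([\rho-\sigma]_+)_{A_k}$, where $[\rho-\sigma]_+$ is the positive part of $\rho-\sigma$. -/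

import Mathlib

open scoped ENNReal InnerProductSpace

noncomputable section

namespace QState

/-! ### Traces, entropy, rank and support on a single Hilbert space -/

section Single

variable (E : Type*) [NormedAddCommGroup E] [InnerProductSpace ℂ E] [CompleteSpace E]

/-- The index set of a fixed orthonormal (Hilbert) basis of `E`. -/
def BasisIdx : Type _ := ((exists_hilbertBasis ℂ E).choose : Set E)

/-- A fixed orthonormal (Hilbert) basis of `E`. It serves to write down traces and tensor
products in coordinates; none of these notions depends on its choice. -/
def stdBasis : HilbertBasis (BasisIdx E) ℂ E := (exists_hilbertBasis ℂ E).choose_spec.choose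

variable {E}

/-- The trace, in `[0, ∞]`, of a positive bounded operator. -/
def posTrace (A : E →L[ℂ] E) : ℝ≥0∞ :=
  ∑' i, ENNReal.ofReal (RCLike.re ⟪stdBasis E i, A (stdBasis E i)⟫_ℂ)

/-- Parseval's identity. -/
theorem ofReal_norm_sq_eq_tsum {E : Type*} [NormedAddCommGroup E] [InnerProductSpace ℂ E]
    {ι : Type*} (b : HilbertBasis ι ℂ E) (x : E) :
    ENNReal.ofReal (‖x‖ ^ 2) = ∑' i, ENNReal.ofReal (‖⟪b i, x⟫_ℂ‖ ^ 2) := by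
  have h2 : HasSum (fun i => ‖⟪b i, x⟫_ℂ‖ ^ 2) (‖x‖ ^ 2) := by
    rw [← Complex.hasSum_ofReal]
    have h := b.hasSum_inner_mul_inner x x
    rw [inner_self_eq_norm_sq_to_K] at h
    have hc : (fun i => ⟪x, b i⟫_ℂ * ⟪b i, x⟫_ℂ)
        = fun i => ((‖⟪b i, x⟫_ℂ‖ ^ 2 : ℝ) : ℂ) := by
      funext i
      rw [← inner_conj_symm x (b i), RCLike.conj_mul]
      norm_cast
    rw [hc] at h
    have hx : ((‖x‖ : ℂ)) ^ 2 = ((‖x‖ ^ 2 : ℝ) : ℂ) := by push_cast; rfl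
    exact hx ▸ h
  rw [← h2.tsum_eq, ENNReal.ofReal_tsum_of_nonneg (fun i => by positivity) h2.summable]

/-- The trace of a positive operator may be computed in any orthonormal basis. -/
theorem posTrace_eq {ι : Type*} (b : HilbertBasis ι ℂ E) {A : E →L[ℂ] E} (hA : 0 ≤ A) :
    posTrace A = ∑' i, ENNReal.ofReal (RCLike.re ⟪b i, A (b i)⟫_ℂ) := by
  obtain ⟨B, rfl⟩ := CStarAlgebra.nonneg_iff_eq_star_mul_self.mp hA
  have h1 : ∀ x : E, RCLike.re ⟪x, (star B * B) x⟫_ℂ = ‖B x‖ ^ 2 := by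
    intro x
    change RCLike.re ⟪x, (ContinuousLinearMap.adjoint B) (B x)⟫_ℂ = _
    rw [ContinuousLinearMap.adjoint_inner_right, inner_self_eq_norm_sq]
  have h2 : ∀ i j, ‖⟪stdBasis E j, B (b i)⟫_ℂ‖ ^ 2
      = ‖⟪b i, (ContinuousLinearMap.adjoint B) (stdBasis E j)⟫_ℂ‖ ^ 2 := by
    intro i j
    rw [ContinuousLinearMap.adjoint_inner_right, norm_inner_symm]
  have h3 : ∀ i j, ‖⟪stdBasis E j, B (stdBasis E i)⟫_ℂ‖ ^ 2
      = ‖⟪stdBasis E i, (ContinuousLinearMap.adjoint B) (stdBasis E j)⟫_ℂ‖ ^ 2 := by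
    intro i j
    rw [ContinuousLinearMap.adjoint_inner_right, norm_inner_symm]
  have hb : ∑' i, ENNReal.ofReal (‖B (b i)‖ ^ 2)
      = ∑' j, ENNReal.ofReal (‖(ContinuousLinearMap.adjoint B) (stdBasis E j)‖ ^ 2) := by
    simp_rw [fun i => ofReal_norm_sq_eq_tsum (stdBasis E) (B (b i)), h2]
    rw [ENNReal.tsum_comm]
    simp_rw [← ofReal_norm_sq_eq_tsum b]
  have hs : ∑' i, ENNReal.ofReal (‖B (stdBasis E i)‖ ^ 2)
      = ∑' j, ENNReal.ofReal (‖(ContinuousLinearMap.adjoint B) (stdBasis E j)‖ ^ 2) := by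
    simp_rw [fun i => ofReal_norm_sq_eq_tsum (stdBasis E) (B (stdBasis E i)), h3]
    rw [ENNReal.tsum_comm]
    simp_rw [← ofReal_norm_sq_eq_tsum (stdBasis E)]
  rw [posTrace]
  simp_rw [h1]
  rw [hs, hb]

/-- The trace norm `‖A‖₁ = Tr |A|`. -/
def traceNorm (A : E →L[ℂ] E) : ℝ≥0∞ := posTrace (CFC.abs A)

/-- The positive part `[A]_+` of a Hermitian operator. -/
def opPos (A : E →L[ℂ] E) : E →L[ℂ] E := A⁺

variable (E) in
/-- The set of quantum states: positive operators with unit trace. -/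
def states : Set (E →L[ℂ] E) := {ρ | 0 ≤ ρ ∧ posTrace ρ = 1}

/-- The von Neumann entropy `S(ρ) = Tr η(ρ)`, `η(x) = -x ln x`, with values in `[0, ∞]`. -/
def entropy (ρ : E →L[ℂ] E) : ℝ≥0∞ := posTrace (cfc Real.negMulLog ρ)

/-- The rank of an operator, in `ℕ ∪ {∞}`. -/
def rank (A : E →L[ℂ] E) : ℕ∞ := Cardinal.toENat (LinearMap.rank (A : E →ₗ[ℂ] E))

/-- The support of a positive operator: the closure of its range. -/
def supp (A : E →L[ℂ] E) : Submodule ℂ E :=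
  (LinearMap.range (A : E →ₗ[ℂ] E)).topologicalClosure

/-- `d_*(ρ, σ)`: the dimension of the minimal subspace containing the supports of `ρ` and `σ`. -/
def dStar (ρ σ : E →L[ℂ] E) : ℕ∞ :=
  Cardinal.toENat (Module.rank ℂ (supp ρ ⊔ supp σ : Submodule ℂ E))

end Single

/-! ### The Hilbert space tensor product of `n` Hilbert spaces and marginal operators -/

section Tensor

theorem hasSum_pi_prod {n : ℕ} : ∀ {α : Fin n → Type*} (f : ∀ k, α k → ℂ),
    (∀ k, Summable fun a => ‖f k a‖) →
    Summable (fun i : ∀ k, α k => ‖∏ k, f k (i k)‖) ∧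
    HasSum (fun i : ∀ k, α k => ∏ k, f k (i k)) (∏ k, ∑' a, f k a) := by
  induction n with
  | zero =>
    intro α f _
    let _ : Fintype (∀ k : Fin 0, α k) := Unique.fintype
    refine ⟨(hasSum_fintype _).summable, ?_⟩
    convert hasSum_fintype (fun i : ∀ k : Fin 0, α k => ∏ k, f k (i k)) using 1
    simp
  | succ n ih =>
    intro α f hf
    obtain ⟨h1, h2⟩ := ih (fun k => f k.succ) (fun k => hf k.succ)
    have hs := summable_mul_of_summable_norm' (f := f 0) (hf 0) (hf 0).of_norm h1 h2.summable
    have hn := (hf 0).mul_norm h1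
    rw [← (Fin.consEquiv α).summable_iff, ← (Fin.consEquiv α).hasSum_iff]
    simp only [Function.comp_def, Fin.consEquiv, Equiv.coe_fn_mk, Fin.prod_univ_succ,
      Fin.cons_zero, Fin.cons_succ]
    refine ⟨hn, ?_⟩
    have := tsum_mul_tsum_of_summable_norm (hf 0) h1
    rw [← h2.tsum_eq, this]
    exact hs.hasSum

variable {n : ℕ} (H : Fin n → Type*) [∀ k, NormedAddCommGroup (H k)]
  [∀ k, InnerProductSpace ℂ (H k)] [∀ k, CompleteSpace (H k)]

/-- The Hilbert space tensor product `H_1 ⊗ ⋯ ⊗ H_n`, written in coordinates with respect to the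
product orthonormal basis. -/
abbrev HTensor : Type _ := lp (fun _ : (∀ k, BasisIdx (H k)) => ℂ) 2

variable {H}

theorem summable_norm_repr_mul {E : Type*} [NormedAddCommGroup E] [InnerProductSpace ℂ E]
    [CompleteSpace E] (x y : E) :
    Summable fun a => ‖⟪(stdBasis E).repr x a, (stdBasis E).repr y a⟫_ℂ‖ := by
  generalize (stdBasis E).repr x = u
  generalize (stdBasis E).repr y = v
  exact (lp.summable_inner (𝕜 := ℂ) u v).norm

theorem memℓp_tmul (x : ∀ k, H k) :
    Memℓp (fun i : (∀ k, BasisIdx (H k)) => ∏ k, (stdBasis (H k)).repr (x k) (i k)) 2 := by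
  apply memℓp_gen
  have := (hasSum_pi_prod (fun k a => ⟪(stdBasis (H k)).repr (x k) a,
    (stdBasis (H k)).repr (x k) a⟫_ℂ) (fun k => summable_norm_repr_mul (x k) (x k))).1
  refine this.congr fun i => ?_
  simp [norm_prod, pow_two, Finset.prod_mul_distrib]

/-- The product vector `x_1 ⊗ ⋯ ⊗ x_n`. -/
def tmul (x : ∀ k, H k) : HTensor H :=
  ⟨fun i => ∏ k, (stdBasis (H k)).repr (x k) (i k), memℓp_tmul x⟩

/-- `⟨x_1 ⊗ ⋯ ⊗ x_n, y_1 ⊗ ⋯ ⊗ y_n⟩ = ∏ ⟨x_k, y_k⟩`. -/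
theorem inner_tmul (x y : ∀ k, H k) : ⟪tmul x, tmul y⟫_ℂ = ∏ k, ⟪x k, y k⟫_ℂ := by
  have h := (hasSum_pi_prod (fun k a => ⟪(stdBasis (H k)).repr (x k) a,
    (stdBasis (H k)).repr (y k) a⟫_ℂ) (fun k => summable_norm_repr_mul (x k) (y k))).2
  rw [lp.inner_eq_tsum]
  have h2 : ∏ k, ⟪x k, y k⟫_ℂ = ∏ k, ∑' a, ⟪(stdBasis (H k)).repr (x k) a,
    (stdBasis (H k)).repr (y k) a⟫_ℂ := by
    refine Finset.prod_congr rfl fun k _ => ?_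
    rw [← lp.inner_eq_tsum, LinearIsometryEquiv.inner_map_map]
  rw [h2, ← h.tsum_eq]
  refine tsum_congr fun i => ?_
  simp [tmul, Finset.prod_mul_distrib]

/-- The product vectors of basis vectors are the standard unit vectors. -/
theorem tmul_stdBasis [DecidableEq (∀ k, BasisIdx (H k))] (i : ∀ k, BasisIdx (H k)) :
    tmul (fun k => stdBasis (H k) (i k)) = lp.single 2 i (1 : ℂ) := by
  classical
  ext j
  simp only [tmul, HilbertBasis.repr_self, lp.coeFn_single]
  by_cases hij : j = i
  · subst hij; simp
  · obtain ⟨k, hk⟩ := Function.ne_iff.mp hij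
    rw [Pi.single_eq_of_ne hij]
    exact Finset.prod_eq_zero (Finset.mem_univ k) (by simp [Pi.single_eq_of_ne hk])

variable (H) in
/-- Indices of the product basis of the tensor product of all factors but the `k`-th. -/
abbrev RestIdx (k : Fin n) : Type _ := ∀ l : {l : Fin n // l ≠ k}, BasisIdx (H l)

/-- The tuple with `x` in position `k` and the basis vectors with indices `j` elsewhere. -/
def slotTuple (k : Fin n) (j : RestIdx H k) (x : H k) : ∀ l, H l :=
  Function.update (fun l => if h : l ≠ k then stdBasis (H l) (j ⟨l, h⟩) else 0) k x

/-- The isometry `H_k → H_1 ⊗ ⋯ ⊗ H_n` that tensors `x` in position `k` with the basis vectors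
with indices `j` in the other positions. -/
def slot (k : Fin n) (j : RestIdx H k) : H k →ₗᵢ[ℂ] HTensor H where
  toFun x := tmul (slotTuple k j x)
  map_add' x y := by
    ext i
    simp only [tmul, slotTuple, lp.coeFn_add, Pi.add_apply]
    rw [← Finset.mul_prod_erase _ _ (Finset.mem_univ k),
      ← Finset.mul_prod_erase _ _ (Finset.mem_univ k),
      ← Finset.mul_prod_erase _ _ (Finset.mem_univ k)]
    simp only [Function.update_self, map_add, lp.coeFn_add, Pi.add_apply, add_mul]
    congr 2 <;>
    · refine Finset.prod_congr rfl fun l hl => ?_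
      rw [Function.update_of_ne (Finset.ne_of_mem_erase hl),
        Function.update_of_ne (Finset.ne_of_mem_erase hl)]
  map_smul' c x := by
    ext i
    simp only [tmul, slotTuple, lp.coeFn_smul, Pi.smul_apply, RingHom.id_apply]
    rw [← Finset.mul_prod_erase _ _ (Finset.mem_univ k),
      ← Finset.mul_prod_erase _ _ (Finset.mem_univ k)]
    simp only [Function.update_self, map_smul, lp.coeFn_smul, Pi.smul_apply, smul_eq_mul,
      mul_assoc]
    congr 2
    refine Finset.prod_congr rfl fun l hl => ?_
    rw [Function.update_of_ne (Finset.ne_of_mem_erase hl),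
      Function.update_of_ne (Finset.ne_of_mem_erase hl)]
  norm_map' x := by
    have h : ⟪tmul (slotTuple k j x), tmul (slotTuple k j x)⟫_ℂ = ⟪x, x⟫_ℂ := by
      rw [inner_tmul, ← Finset.mul_prod_erase _ _ (Finset.mem_univ k)]
      have : ∏ l ∈ Finset.univ.erase k, ⟪slotTuple k j x l, slotTuple k j x l⟫_ℂ = 1 := by
        refine Finset.prod_eq_one fun l hl => ?_
        have hl' := Finset.ne_of_mem_erase hl
        rw [slotTuple, Function.update_of_ne hl', dif_pos hl', inner_self_eq_norm_sq_to_K,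
          (stdBasis (H l)).orthonormal.1]
        simp
      rw [this, mul_one, slotTuple, Function.update_self]
    rw [inner_self_eq_norm_sq_to_K, inner_self_eq_norm_sq_to_K] at h
    have h' : ‖tmul (slotTuple k j x)‖ ^ 2 = ‖x‖ ^ 2 := by exact_mod_cast h
    exact (pow_left_inj₀ (norm_nonneg _) (norm_nonneg _) two_ne_zero).mp h'

/-- The marginal operator `A_{A_k}` of a trace class operator `A` on `H_1 ⊗ ⋯ ⊗ H_n`: the partial
trace over all factors but the `k`-th. The series converges absolutely in operator norm whenever
`A` is a positive trace class operator. -/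
def marginal (k : Fin n) (A : HTensor H →L[ℂ] HTensor H) : H k →L[ℂ] H k :=
  ∑' j : RestIdx H k,
    (ContinuousLinearMap.adjoint (slot k j).toContinuousLinearMap) ∘L A ∘L
      (slot k j).toContinuousLinearMap

/-- The first `m` of the `n` subsystems. -/
def firstSys (n m : ℕ) : Finset (Fin n) := Finset.univ.filter fun k => k.val < m

/-- `C_m(ρ) = ∑_{k ≤ m} S(ρ_{A_k})`. -/
def Cm (m : ℕ) (ρ : HTensor H →L[ℂ] HTensor H) : ℝ≥0∞ :=
  ∑ k ∈ firstSys n m, entropy (marginal k ρ)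

/-- `∏_{k ≤ m} rank A_{A_k}`; this is `d_m(ρ)` for `A = ρ`. -/
def dProd (m : ℕ) (A : HTensor H →L[ℂ] HTensor H) : ℕ∞ :=
  ∏ k ∈ firstSys n m, rank (marginal k A)

/-- `d_m(ρ, σ) = max {d_m(ρ), d_m(σ)}`. -/
def dMax (m : ℕ) (ρ σ : HTensor H →L[ℂ] HTensor H) : ℕ∞ := max (dProd m ρ) (dProd m σ)

/-- `d^*_m(ρ, σ) = ∏_{k ≤ m} rank ([ρ - σ]_+)_{A_k}`. -/
def dPlus (m : ℕ) (ρ σ : HTensor H →L[ℂ] HTensor H) : ℕ∞ := dProd m (opPos (ρ - σ))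

/-! ### Classes of functions of a state -/

/-- The class `L_n^m(C, D | S₀)`. A function is represented by any of its extensions to all
operators; only its values on `S₀` matter. -/
def LClass (m : ℕ) (C D : ℝ) (S₀ : Set (HTensor H →L[ℂ] HTensor H)) :
    Set ((HTensor H →L[ℂ] HTensor H) → EReal) :=
  {f | (∀ ρ ∈ S₀, f ρ ≠ ⊥) ∧
    ∃ cm cp dm dp : ℝ, 0 ≤ cm ∧ 0 ≤ cp ∧ 0 ≤ dm ∧ 0 ≤ dp ∧ cm + cp = C ∧ dm + dp = D ∧
      (∀ ρ ∈ S₀, -((cm : EReal) * (Cm m ρ : EReal)) ≤ f ρ ∧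
        f ρ ≤ (cp : EReal) * (Cm m ρ : EReal)) ∧
      ∀ ρ ∈ S₀, ∀ σ ∈ S₀, ∀ p ∈ Set.Icc (0 : ℝ) 1,
        (p : EReal) * f ρ + ((1 - p : ℝ) : EReal) * f σ - ((dm * Real.binEntropy p : ℝ) : EReal)
          ≤ f (p • ρ + (1 - p) • σ) ∧
        f (p • ρ + (1 - p) • σ) ≤
          (p : EReal) * f ρ + ((1 - p : ℝ) : EReal) * f σ
            + ((dp * Real.binEntropy p : ℝ) : EReal)}

/-- The class obtained from a class `L` of functions on `S₀` by adding the pointwise infima and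
suprema of nonempty families of functions in `L`. -/
def hatClass {X : Type*} (S₀ : Set X) (L : Set (X → EReal)) : Set (X → EReal) :=
  {f | f ∈ L ∨ ∃ F ⊆ L, F.Nonempty ∧
    ((∀ ρ ∈ S₀, f ρ = ⨅ g ∈ F, g ρ) ∨ (∀ ρ ∈ S₀, f ρ = ⨆ g ∈ F, g ρ))}

/-- The class `L̂_n^m(C, D | S₀)`. -/
def LHat (m : ℕ) (C D : ℝ) (S₀ : Set (HTensor H →L[ℂ] HTensor H)) :
    Set ((HTensor H →L[ℂ] HTensor H) → EReal) :=
  hatClass S₀ (LClass m C D S₀)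

/-- The nonnegative part of `L̂_n^m(C, D | S₀)`: nonnegative functions in `L_n^m(C, D | S₀)` and
the infima and suprema of families of such functions. -/
def LHatNonneg (m : ℕ) (C D : ℝ) (S₀ : Set (HTensor H →L[ℂ] HTensor H)) :
    Set ((HTensor H →L[ℂ] HTensor H) → EReal) :=
  hatClass S₀ {f | f ∈ LClass m C D S₀ ∧ ∀ ρ ∈ S₀, 0 ≤ f ρ}

/-- The condition `ϱ ∈ S₀`, `cς ≤ ϱ` for some `c > 0`, `[ϱ, ς] = 0` imply `ς ∈ S₀`. -/
def CommutingHereditary (S₀ : Set (HTensor H →L[ℂ] HTensor H)) : Prop :=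
  ∀ ϱ ∈ S₀, ∀ ς ∈ states (HTensor H), (∃ c : ℝ, 0 < c ∧ c • ς ≤ ϱ) → Commute ϱ ς → ς ∈ S₀

end Tensor

/-! ### Bounds -/

/-- The non-decreasing envelope `{g}^↑(x) = sup_{t ∈ [0, x]} g(t)`. -/
def upEnv (g : ℝ → ℝ) (x : ℝ) : ℝ := sSup (g '' Set.Icc 0 x)

/-- The function `h^↑`. -/
def hUp (x : ℝ) : ℝ := if x ≤ 1 / 2 then Real.binEntropy x else Real.log 2

/-- The expression `C ε ln d + D h(ε)`; it is read with `ln 0 = 0`, which is of importance only for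
`ρ = σ`. -/
def bnd (C D d ε : ℝ) : ℝ := C * ε * Real.log d + D * Real.binEntropy ε

/-- The expression `C ε ln d + D h^↑(ε)`, read in the same way. -/
def bndUp (C D d ε : ℝ) : ℝ := C * ε * Real.log d + D * hUp ε

end QState

end

set_option linter.unusedSectionVars false

noncomputable section

namespace QState

/-! ### Positive operators on a single Hilbert space -/

section SingleSpace

variable {E : Type*} [NormedAddCommGroup E] [InnerProductSpace ℂ E] [CompleteSpace E]

/-! Let ρ ≠ σ commute, let ε be half of their trace distance, and put τ = ε⁻¹[ρ - σ]_+ and τ' =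
ε⁻¹[σ - ρ]_+. Commutativity gives [ρ - σ]_+ ≤ ρ (`posPart_sub_le`), so the common remainder ρ - [ρ -
σ]_+ = σ - [σ - ρ]_+ is positive with trace 1 - ε. With ω its normalization, ρ = ετ + (1-ε)ω and σ =
ετ' + (1-ε)ω (`exists_decomposition`), and heredity keeps τ, τ', ω in S₀.

For f in L_n^m, approximate concavity and convexity bound f(ρ) above and f(σ) below. The finite
value f(ω) cancels, so f(ρ) - f(σ) ≤ ε(f(τ) - f(τ')) + D h(ε) ≤ ε(c⁺C_m(τ) + c⁻C_m(τ')) + D h(ε)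
(`LClass_le_add`). Entropy is at most the logarithm of the rank (`entropy_le_log_rank`), hence C_m ≤
ln d_m. Ranks of marginals do not grow under domination up to a positive factor (`dProd_le`), so
d_m(τ) ≤ d_m(ρ) and d_m(τ') ≤ d_m(σ).

If f ≥ 0, then f(τ') ≥ 0 and only τ contributes, which gives d_m^*. For a single factor, τ and τ'
have orthogonal ranges inside the sum of the supports, so each rank is at most d_* - 1. The bounds
do not depend on f, so they survive infima and suprema (`hatClass_le_add`). -/

theorem re_inner_nonneg_of_nonneg {A : E →L[ℂ] E} (hA : 0 ≤ A) (x : E) :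
    0 ≤ RCLike.re ⟪x, A x⟫_ℂ :=
  ((ContinuousLinearMap.nonneg_iff_isPositive A).mp hA).re_inner_nonneg_right x

theorem re_inner_le_of_le {A B : E →L[ℂ] E} (h : A ≤ B) (x : E) :
    RCLike.re ⟪x, A x⟫_ℂ ≤ RCLike.re ⟪x, B x⟫_ℂ := by
  have := re_inner_nonneg_of_nonneg (sub_nonneg.mpr h) x
  simpa [inner_sub_right] using this

theorem eq_zero_of_re_inner_eq_zero {A : E →L[ℂ] E} (hA : 0 ≤ A) {x : E}
    (h : RCLike.re ⟪x, A x⟫_ℂ ≤ 0) : A x = 0 := by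
  obtain ⟨B, rfl⟩ := CStarAlgebra.nonneg_iff_eq_star_mul_self.mp hA
  change RCLike.re ⟪x, (ContinuousLinearMap.adjoint B) (B x)⟫_ℂ ≤ 0 at h
  rw [ContinuousLinearMap.adjoint_inner_right, inner_self_eq_norm_sq] at h
  have : B x = 0 := by
    rw [← norm_eq_zero]
    exact pow_eq_zero_iff two_ne_zero |>.mp (le_antisymm h (by positivity))
  simp [this]

theorem apply_eq_zero_of_le {A B : E →L[ℂ] E} (hA : 0 ≤ A) (h : A ≤ B) {x : E} (hx : B x = 0) :
    A x = 0 := by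
  apply eq_zero_of_re_inner_eq_zero hA
  simpa [hx] using re_inner_le_of_le h x

theorem posTrace_add {A B : E →L[ℂ] E} (hA : 0 ≤ A) (hB : 0 ≤ B) :
    posTrace (A + B) = posTrace A + posTrace B := by
  rw [posTrace, posTrace, posTrace, ← ENNReal.tsum_add]
  refine tsum_congr fun i => ?_
  rw [← ENNReal.ofReal_add (re_inner_nonneg_of_nonneg hA _) (re_inner_nonneg_of_nonneg hB _)]
  simp

theorem posTrace_smul {c : ℝ} (hc : 0 ≤ c) (A : E →L[ℂ] E) :
    posTrace (c • A) = ENNReal.ofReal c * posTrace A := by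
  rw [posTrace, posTrace, ← ENNReal.tsum_mul_left]
  refine tsum_congr fun i => ?_
  rw [← ENNReal.ofReal_mul hc]
  congr 1
  rw [smul_apply, inner_smul_right_eq_smul]
  simp

theorem real_smul_nonneg {c : ℝ} (hc : 0 ≤ c) {A : E →L[ℂ] E} (hA : 0 ≤ A) : 0 ≤ c • A :=
  smul_nonneg hc hA

theorem posTrace_mono {A B : E →L[ℂ] E} (h : A ≤ B) : posTrace A ≤ posTrace B :=
  ENNReal.tsum_le_tsum fun _ => ENNReal.ofReal_le_ofReal (re_inner_le_of_le h _)

/-- Writing A = B*B, the trace is the sum of ‖B e_i‖², and Parseval with Cauchy–Schwarz gives ‖B*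
y‖² ≤ Tr A · ‖y‖². This yields both ‖ρ‖ ≤ 1 for states and the norm convergence of the series for
marginals. -/
theorem enorm_le_posTrace {A : E →L[ℂ] E} (hA : 0 ≤ A) : ‖A‖ₑ ≤ posTrace A := by
  by_cases htop : posTrace A = ⊤
  · simp [htop]
  obtain ⟨B, rfl⟩ := CStarAlgebra.nonneg_iff_eq_star_mul_self.mp hA
  set t := posTrace (star B * B) with ht
  have h1 : ∀ x : E, RCLike.re ⟪x, (star B * B) x⟫_ℂ = ‖B x‖ ^ 2 := by
    intro x
    change RCLike.re ⟪x, (ContinuousLinearMap.adjoint B) (B x)⟫_ℂ = _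
    rw [ContinuousLinearMap.adjoint_inner_right, inner_self_eq_norm_sq]
  have h2 : ∀ y, ‖(ContinuousLinearMap.adjoint B) y‖ ^ 2 ≤ t.toReal * ‖y‖ ^ 2 := by
    intro y
    rw [← ENNReal.ofReal_le_ofReal_iff (by positivity), ENNReal.ofReal_mul (by positivity),
      ENNReal.ofReal_toReal htop, ht, ofReal_norm_sq_eq_tsum (stdBasis E), posTrace,
      ← ENNReal.tsum_mul_right]
    refine ENNReal.tsum_le_tsum fun i => ?_
    rw [h1, ContinuousLinearMap.adjoint_inner_right, ← ENNReal.ofReal_mul (by positivity),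
      ← mul_pow]
    exact ENNReal.ofReal_le_ofReal (pow_le_pow_left₀ (norm_nonneg _) (norm_inner_le_norm _ _) 2)
  have h3 : ‖star B‖ ≤ √t.toReal := by
    refine ContinuousLinearMap.opNorm_le_bound _ (Real.sqrt_nonneg _) fun y => ?_
    change ‖(ContinuousLinearMap.adjoint B) y‖ ≤ _
    refine le_of_sq_le_sq ?_ (by positivity)
    rw [mul_pow, Real.sq_sqrt ENNReal.toReal_nonneg]
    exact h2 y
  have h4 : ‖star B * B‖ ≤ t.toReal := by
    rw [CStarRing.norm_star_mul_self, ← sq, ← norm_star B, ← Real.sq_sqrt ENNReal.toReal_nonneg]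
    exact pow_le_pow_left₀ (norm_nonneg _) h3 2
  rw [← ofReal_norm, ← ENNReal.ofReal_toReal htop]
  exact ENNReal.ofReal_le_ofReal h4

theorem eq_zero_of_posTrace_eq_zero {A : E →L[ℂ] E} (hA : 0 ≤ A) (h : posTrace A = 0) : A = 0 := by
  have := enorm_le_posTrace hA
  rw [h] at this
  simpa using this

/-- An operator whose kernel contains the kernel of `B` has at most the rank of `B`. -/
theorem rank_le_of_ker {A B : E →L[ℂ] E} (h : ∀ x, B x = 0 → A x = 0) : rank A ≤ rank B := by
  have hk : LinearMap.ker (B : E →ₗ[ℂ] E) ≤ LinearMap.ker (A : E →ₗ[ℂ] E) := fun x hx => h x hx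
  -- A factors through the range of B: `e` identifies E / ker B with that range, and A descends to E
  -- / ker B.
  let q := (LinearMap.ker (B : E →ₗ[ℂ] E)).liftQ (A : E →ₗ[ℂ] E) hk
  let e := (B : E →ₗ[ℂ] E).quotKerEquivRange
  have hA : (A : E →ₗ[ℂ] E) = (q ∘ₗ e.symm.toLinearMap) ∘ₗ (B : E →ₗ[ℂ] E).rangeRestrict := by
    ext x
    have : e.symm ((B : E →ₗ[ℂ] E).rangeRestrict x) = Submodule.Quotient.mk x := by
      rw [LinearEquiv.symm_apply_eq]
      ext
      simp [e]
    simp only [LinearMap.comp_apply, LinearEquiv.coe_coe, this]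
    simp [q]
  refine Cardinal.toENat.monotone' ?_
  have h1 := LinearMap.rank_le_domain (q ∘ₗ e.symm.toLinearMap)
  have h2 : LinearMap.range (A : E →ₗ[ℂ] E) ≤ LinearMap.range (q ∘ₗ e.symm.toLinearMap) := by
    rw [hA]
    exact LinearMap.range_comp_le_range _ _
  exact (Submodule.rank_mono h2).trans h1

theorem rank_le_of_smul_le {A B : E →L[ℂ] E} (hA : 0 ≤ A) {c : ℝ} (hc : 0 < c) (h : c • A ≤ B) :
    rank A ≤ rank B := by
  refine rank_le_of_ker fun x hx => ?_
  have := apply_eq_zero_of_le (smul_nonneg hc.le hA) h hx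
  simpa [hc.ne'] using this

theorem finiteDimensional_range_of_rank_ne_top {A : E →L[ℂ] E} (h : rank A ≠ ⊤) :
    FiniteDimensional ℂ (LinearMap.range (A : E →ₗ[ℂ] E)) := by
  rw [rank, ne_eq, Cardinal.toENat_eq_top, not_le] at h
  exact Module.rank_lt_aleph0_iff.mp h

theorem rank_eq_finrank {A : E →L[ℂ] E} (h : rank A ≠ ⊤) :
    rank A = Module.finrank ℂ (LinearMap.range (A : E →ₗ[ℂ] E)) := by
  have := finiteDimensional_range_of_rank_ne_top h
  rw [rank, LinearMap.rank, ← Module.finrank_eq_rank, Cardinal.toENat_nat]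

theorem rank_ne_top_of_finiteDimensional {A : E →L[ℂ] E}
    [FiniteDimensional ℂ (LinearMap.range (A : E →ₗ[ℂ] E))] : rank A ≠ ⊤ := by
  rw [rank, LinearMap.rank, ← Module.finrank_eq_rank, Cardinal.toENat_nat]
  exact ENat.natCast_ne_top _

theorem rank_eq_zero_iff {A : E →L[ℂ] E} : rank A = 0 ↔ A = 0 := by
  rw [rank, Cardinal.toENat_eq_zero, LinearMap.rank, rank_zero_iff]
  rw [Submodule.subsingleton_iff_eq_bot, LinearMap.range_eq_bot]
  exact ⟨fun h => by ext x; exact congr($h x), fun h => by rw [h]; rfl⟩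

/-- The tangent at `c` lies above the concave function η. Through the functional calculus it becomes
an affine operator bound on η(A), which replaces any diagonalization of A. -/
theorem negMulLog_le_tangent {x c : ℝ} (hx : 0 ≤ x) (hc : 0 < c) :
    Real.negMulLog x ≤ (-Real.log c - 1) * x + c := by
  rcases hx.eq_or_lt with rfl | hx
  · simp [hc.le]
  have h := Real.log_le_sub_one_of_pos (div_pos hc hx)
  rw [Real.log_div hc.ne' hx.ne'] at h
  have h2 := mul_le_mul_of_nonneg_left h hx.le
  have h3 : x * (c / x) = c := by field_simp
  rw [Real.negMulLog]
  nlinarith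

theorem cfc_negMulLog_nonneg {A : E →L[ℂ] E} (hA : 0 ≤ A) (h1 : ‖A‖ ≤ 1) :
    0 ≤ cfc Real.negMulLog A := by
  refine cfc_nonneg fun x hx => ?_
  have hx0 : 0 ≤ x := spectrum_nonneg_of_nonneg hA hx
  refine Real.negMulLog_nonneg hx0 ?_
  have := spectrum.norm_le_norm_mul_of_mem hx
  have h2 : ‖(1 : E →L[ℂ] E)‖ ≤ 1 := ContinuousLinearMap.norm_id_le
  calc x ≤ ‖x‖ := le_abs_self x
    _ ≤ ‖A‖ * ‖(1 : E →L[ℂ] E)‖ := this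
    _ ≤ 1 := by nlinarith [norm_nonneg A, norm_nonneg (1 : E →L[ℂ] E)]

theorem cfc_negMulLog_le {A : E →L[ℂ] E} (hA : 0 ≤ A) {c : ℝ} (hc : 0 < c) :
    cfc Real.negMulLog A ≤ (-Real.log c - 1) • A + c • (1 : E →L[ℂ] E) := by
  have hs : IsSelfAdjoint A := .of_nonneg hA
  have h : cfc (fun x : ℝ => (-Real.log c - 1) * x + c) A
      = (-Real.log c - 1) • A + c • (1 : E →L[ℂ] E) := by
    rw [cfc_add_const c (fun x : ℝ => (-Real.log c - 1) * x) A, cfc_const_mul_id _ A,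
      Algebra.algebraMap_eq_smul_one]
  rw [← h]
  exact cfc_mono (fun x hx => negMulLog_le_tangent (spectrum_nonneg_of_nonneg hA hx) hc)
    (Real.continuous_negMulLog.continuousOn) (by fun_prop)

end SingleSpace

/-! ### Entropy and rank -/

section SingleSpace

variable {E : Type*} [NormedAddCommGroup E] [InnerProductSpace ℂ E] [CompleteSpace E]

theorem inner_apply_comm {A : E →L[ℂ] E} (hA : 0 ≤ A) (x y : E) : ⟪A x, y⟫_ℂ = ⟪x, A y⟫_ℂ :=
  ((ContinuousLinearMap.nonneg_iff_isPositive A).mp hA).isSymmetric x y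

/-- The trace of an operator vanishing on `Rᗮ`, for a finite-dimensional `R`, is computed in an
orthonormal basis of `R`. -/
theorem posTrace_eq_sum_of_orthogonal (R : Submodule ℂ E) [FiniteDimensional ℂ R]
    {A : E →L[ℂ] E} (hA : 0 ≤ A) (h : ∀ x ∈ Rᗮ, A x = 0) :
    posTrace A = ∑ i, ENNReal.ofReal (RCLike.re
      ⟪(stdOrthonormalBasis ℂ R i : E), A (stdOrthonormalBasis ℂ R i)⟫_ℂ) := by
  classical
  set o := stdOrthonormalBasis ℂ R
  have ho : Orthonormal ℂ (fun i => (o i : E)) := o.orthonormal.comp_linearIsometry R.subtypeₗᵢ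
  -- Extend the basis of `R` to a Hilbert basis of `E`; the added vectors lie in Rᗮ and contribute
  -- nothing.
  obtain ⟨w, b, hsw, hb⟩ := ho.toSubtypeRange.exists_hilbertBasis_extension
  let φ : Fin (Module.finrank ℂ R) → w := fun i => ⟨o i, hsw ⟨i, rfl⟩⟩
  have hφ : Function.Injective φ := fun i j hij =>
    ho.linearIndependent.injective (congrArg (fun z : w => (z : E)) hij)
  have hbv : ∀ i, b i = (i : E) := fun i => congrFun hb i
  rw [posTrace_eq b hA, tsum_eq_sum (s := Finset.univ.image φ),
    Finset.sum_image (fun _ _ _ _ hij => hφ hij)]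
  · simp [hbv, φ]
  · intro i hi
    have hi' : b i ∈ Rᗮ := by
      rw [Submodule.mem_orthogonal]
      intro u hu
      have hrep := congrArg Subtype.val (o.sum_repr ⟨u, hu⟩)
      rw [← show (((⟨u, hu⟩ : R)) : E) = u from rfl, ← hrep]
      simp only [Submodule.coe_sum, sum_inner, Submodule.coe_smul, inner_smul_left]
      refine Finset.sum_eq_zero fun j _ => ?_
      have hne : φ j ≠ i := fun hj => hi (Finset.mem_image.mpr ⟨j, Finset.mem_univ _, hj⟩)
      have h0 : ⟪b (φ j), b i⟫_ℂ = 0 := b.orthonormal.2 hne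
      rw [hbv (φ j)] at h0
      rw [show ⟪(o j : E), b i⟫_ℂ = 0 from h0, mul_zero]
    simp [h _ hi']

theorem apply_eq_zero_of_mem_orthogonal_range {A : E →L[ℂ] E} (hA : 0 ≤ A) {x : E}
    (hx : x ∈ (LinearMap.range (A : E →ₗ[ℂ] E))ᗮ) : A x = 0 := by
  apply eq_zero_of_re_inner_eq_zero hA
  rw [← inner_apply_comm hA]
  have h : ⟪A x, x⟫_ℂ = 0 := (Submodule.mem_orthogonal _ _).mp hx _ ⟨x, rfl⟩
  simp [h]

/-- On ker A the tangent bound reads ⟨x, η(A)x⟩ ≤ c‖x‖² for every c > 0; let c tend to 0. -/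
theorem cfc_negMulLog_apply_eq_zero {A : E →L[ℂ] E} (hA : 0 ≤ A) (h1 : ‖A‖ ≤ 1) {x : E}
    (hx : A x = 0) : cfc Real.negMulLog A x = 0 := by
  apply eq_zero_of_re_inner_eq_zero (cfc_negMulLog_nonneg hA h1)
  refine le_of_forall_pos_le_add fun δ hδ => ?_
  rw [zero_add]
  have hc : 0 < δ / (‖x‖ ^ 2 + 1) := by positivity
  refine (re_inner_le_of_le (cfc_negMulLog_le hA hc) x).trans ?_
  simp only [add_apply, smul_apply, hx, smul_zero, zero_add, one_apply_eq_self]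
  rw [inner_smul_right_eq_smul, RCLike.smul_re, inner_self_eq_norm_sq,
    div_mul_eq_mul_div, div_le_iff₀ (by positivity)]
  nlinarith [sq_nonneg ‖x‖]

/-- The entropy of a state is at most the logarithm of its rank. -/
theorem entropy_le_log_rank {ρ : E →L[ℂ] E} (hρ : ρ ∈ states E) (hr : rank ρ ≠ ⊤) :
    entropy ρ ≤ ENNReal.ofReal (Real.log (rank ρ).toNat) := by
  obtain ⟨h0, htr⟩ := hρ
  have := finiteDimensional_range_of_rank_ne_top hr
  set R := LinearMap.range (ρ : E →ₗ[ℂ] E)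
  set o := stdOrthonormalBasis ℂ R
  have hnorm : ‖ρ‖ ≤ 1 := by
    have := enorm_le_posTrace h0
    rw [htr, ← ofReal_norm, ← ENNReal.ofReal_one] at this
    exact (ENNReal.ofReal_le_ofReal_iff zero_le_one).mp this
  have hη := cfc_negMulLog_nonneg h0 hnorm
  have hker : ∀ x ∈ Rᗮ, ρ x = 0 := fun x hx => apply_eq_zero_of_mem_orthogonal_range h0 hx
  have hsum := posTrace_eq_sum_of_orthogonal R h0 hker
  have hsumη := posTrace_eq_sum_of_orthogonal R hη
    (fun x hx => cfc_negMulLog_apply_eq_zero h0 hnorm (hker x hx))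
  rw [htr, ← ENNReal.ofReal_sum_of_nonneg (fun i _ => re_inner_nonneg_of_nonneg h0 _)] at hsum
  have hsum' : ∑ i, RCLike.re ⟪(o i : E), ρ (o i)⟫_ℂ = 1 := by
    rw [← ENNReal.ofReal_one, eq_comm, ENNReal.ofReal_eq_ofReal_iff
      (Finset.sum_nonneg fun i _ => re_inner_nonneg_of_nonneg h0 _) zero_le_one] at hsum
    exact hsum
  rw [entropy, hsumη, ← ENNReal.ofReal_sum_of_nonneg (fun i _ => re_inner_nonneg_of_nonneg hη _)]
  refine ENNReal.ofReal_le_ofReal ?_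
  rw [rank_eq_finrank hr, ENat.toNat_natCast]
  change ∑ i, RCLike.re ⟪(o i : E), cfc Real.negMulLog ρ (o i)⟫_ℂ
    ≤ Real.log (Module.finrank ℂ R : ℕ)
  have hr0 : 0 < Module.finrank ℂ R := by
    rcases Nat.eq_zero_or_pos (Module.finrank ℂ R) with h | h
    · exfalso
      have : IsEmpty (Fin (Module.finrank ℂ R)) := by rw [h]; infer_instance
      rw [Finset.univ_eq_empty, Finset.sum_empty] at hsum'
      exact zero_ne_one hsum'
    · exact h
  have hr0' : (0 : ℝ) < Module.finrank ℂ R := by exact_mod_cast hr0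
  -- With r the rank, the tangent at c = 1/r, the eigenvalue of the maximally mixed state, gives (ln
  -- r - 1)·Tr ρ + r·(1/r) = ln r.
  calc ∑ i, RCLike.re ⟪(o i : E), cfc Real.negMulLog ρ (o i)⟫_ℂ
      ≤ ∑ i, ((-Real.log (Module.finrank ℂ R : ℝ)⁻¹ - 1) * RCLike.re ⟪(o i : E), ρ (o i)⟫_ℂ + (Module.finrank ℂ R : ℝ)⁻¹) := by
        refine Finset.sum_le_sum fun i _ => ?_
        refine (re_inner_le_of_le (cfc_negMulLog_le h0 (inv_pos.mpr hr0')) _).trans (le_of_eq ?_)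
        have ho : ‖(o i : E)‖ = 1 := o.orthonormal.1 i
        simp only [add_apply, smul_apply, one_apply_eq_self, inner_add_right, map_add]
        rw [inner_smul_right_eq_smul, inner_smul_right_eq_smul, RCLike.smul_re, RCLike.smul_re,
          inner_self_eq_norm_sq, ho]
        simp
    _ = Real.log (Module.finrank ℂ R) := by
        rw [Finset.sum_add_distrib, ← Finset.mul_sum, hsum']
        simp only [Real.log_inv, Finset.sum_const, Finset.card_univ, Fintype.card_fin, nsmul_eq_mul]
        rw [mul_inv_cancel₀ hr0'.ne']
        ring

/-! ### Positive and negative parts of the difference of commuting positive operators -/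

/-- (ρ + σ)² - (ρ - σ)² = 4ρσ is positive because ρ and σ commute, and the square root is operator
monotone. -/
theorem abs_sub_le_add {ρ σ : E →L[ℂ] E} (hρ : 0 ≤ ρ) (hσ : 0 ≤ σ) (hc : Commute ρ σ) :
    CFC.abs (ρ - σ) ≤ ρ + σ := by
  have hs : IsSelfAdjoint (ρ - σ) := (IsSelfAdjoint.of_nonneg hρ).sub (.of_nonneg hσ)
  have h4 : 0 ≤ ρ * σ := hc.mul_nonneg hρ hσ
  have hle : star (ρ - σ) * (ρ - σ) ≤ (ρ + σ) * (ρ + σ) := by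
    rw [hs.star_eq, ← sub_nonneg]
    have : (ρ + σ) * (ρ + σ) - (ρ - σ) * (ρ - σ) = ρ * σ + ρ * σ + (ρ * σ + ρ * σ) := by
      have := hc.eq
      simp only [mul_add, add_mul, mul_sub, sub_mul, ← this]
      abel
    rw [this]
    exact add_nonneg (add_nonneg h4 h4) (add_nonneg h4 h4)
  have := CFC.sqrt_le_sqrt _ _ hle
  rwa [CFC.sqrt_mul_self _ (add_nonneg hρ hσ)] at this

/-- 2(ρ - σ)⁺ = |ρ - σ| + (ρ - σ) ≤ (ρ + σ) + (ρ - σ) = 2ρ. Commutativity enters through the bound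
on |ρ - σ|. -/
theorem posPart_sub_le {ρ σ : E →L[ℂ] E} (hρ : 0 ≤ ρ) (hσ : 0 ≤ σ) (hc : Commute ρ σ) :
    (ρ - σ)⁺ ≤ ρ := by
  have hs : IsSelfAdjoint (ρ - σ) := (IsSelfAdjoint.of_nonneg hρ).sub (.of_nonneg hσ)
  have h1 := CFC.posPart_add_negPart (ρ - σ) hs
  have h2 := CFC.posPart_sub_negPart (ρ - σ) hs
  have h3 : (2 : ℝ) • (ρ - σ)⁺ ≤ (2 : ℝ) • ρ := by
    have : (2 : ℝ) • (ρ - σ)⁺ = CFC.abs (ρ - σ) + (ρ - σ) := by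
      calc (2 : ℝ) • (ρ - σ)⁺ = ((ρ - σ)⁺ + (ρ - σ)⁻) + ((ρ - σ)⁺ - (ρ - σ)⁻) := by
            rw [two_smul]; abel
        _ = _ := by rw [h1, h2]
    rw [this, two_smul]
    calc _ ≤ (ρ + σ) + (ρ - σ) := by gcongr; exact abs_sub_le_add hρ hσ hc
      _ = _ := by abel
  exact le_of_smul_le_smul_left h3 two_pos

theorem commute_posPart_sub {ρ σ : E →L[ℂ] E} (hc : Commute ρ σ) : Commute ρ (ρ - σ)⁺ := by
  rw [CFC.posPart_def]
  exact (Commute.cfcₙ_real ((Commute.refl ρ).sub_right hc).symm _).symm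

theorem negPart_eq_posPart_sub_swap (ρ σ : E →L[ℂ] E) : (ρ - σ)⁻ = (σ - ρ)⁺ := by
  rw [← CFC.posPart_neg, neg_sub]

end SingleSpace

/-! ### Marginal operators of positive trace class operators -/

section Marginals

variable {n : ℕ} {H : Fin n → Type*} [∀ k, NormedAddCommGroup (H k)]
  [∀ k, InnerProductSpace ℂ (H k)] [∀ k, CompleteSpace (H k)]

variable (H) in
/-- The product orthonormal basis of the tensor product. -/
def prodBasis : HilbertBasis (∀ k, BasisIdx (H k)) ℂ (HTensor H) :=
  ⟨LinearIsometryEquiv.refl ℂ _⟩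

theorem prodBasis_apply (i : ∀ k, BasisIdx (H k)) :
    prodBasis H i = tmul fun k => stdBasis (H k) (i k) := by
  classical
  rw [tmul_stdBasis, ← HilbertBasis.repr_symm_single]
  rfl

/-- The term with index `j` in the series defining the marginal operator. -/
def marginalTerm (k : Fin n) (A : HTensor H →L[ℂ] HTensor H) (j : RestIdx H k) :
    H k →L[ℂ] H k :=
  (ContinuousLinearMap.adjoint (slot k j).toContinuousLinearMap) ∘L A ∘L
      (slot k j).toContinuousLinearMap

theorem inner_marginalTerm (k : Fin n) (A : HTensor H →L[ℂ] HTensor H) (j : RestIdx H k)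
    (x : H k) : ⟪x, marginalTerm k A j x⟫_ℂ = ⟪slot k j x, A (slot k j x)⟫_ℂ := by
  simp [marginalTerm, ContinuousLinearMap.adjoint_inner_right]

theorem marginalTerm_nonneg (k : Fin n) {A : HTensor H →L[ℂ] HTensor H} (hA : 0 ≤ A)
    (j : RestIdx H k) : 0 ≤ marginalTerm k A j := by
  rw [ContinuousLinearMap.nonneg_iff_isPositive] at hA ⊢
  exact hA.adjoint_conj _

theorem marginalTerm_mono (k : Fin n) {A B : HTensor H →L[ℂ] HTensor H} (h : A ≤ B)
    (j : RestIdx H k) : marginalTerm k A j ≤ marginalTerm k B j := by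
  have := marginalTerm_nonneg k (sub_nonneg.mpr h) j
  rw [← sub_nonneg]
  refine this.trans_eq ?_
  ext x
  simp [marginalTerm]

theorem marginalTerm_smul (k : Fin n) (c : ℝ) (A : HTensor H →L[ℂ] HTensor H)
    (j : RestIdx H k) : marginalTerm k (c • A) j = c • marginalTerm k A j := by
  ext x
  simp only [marginalTerm, ContinuousLinearMap.comp_apply, smul_apply]
  rw [ContinuousLinearMap.map_smul_of_tower]

theorem slot_stdBasis (k : Fin n) (j : RestIdx H k) (a : BasisIdx (H k)) :
    slot k j (stdBasis (H k) a)
      = prodBasis H ((Equiv.piSplitAt k fun l => BasisIdx (H l)).symm (a, j)) := by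
  rw [prodBasis_apply]
  change tmul _ = tmul _
  congr 1
  funext l
  by_cases h : l = k
  · subst h
    simp [slotTuple, Equiv.piSplitAt]
  · simp [slotTuple, Equiv.piSplitAt, h]

/-- Summing over `j` and over a basis of the `k`-th factor runs once through the product basis. -/
theorem tsum_posTrace_marginalTerm (k : Fin n) {A : HTensor H →L[ℂ] HTensor H} (hA : 0 ≤ A) :
    ∑' j, posTrace (marginalTerm k A j) = posTrace A := by
  rw [posTrace_eq (prodBasis H) hA,
    ← (Equiv.piSplitAt k fun l => BasisIdx (H l)).symm.tsum_eq, ENNReal.tsum_prod',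
    ENNReal.tsum_comm]
  refine tsum_congr fun j => ?_
  rw [posTrace]
  refine tsum_congr fun a => ?_
  rw [inner_marginalTerm, slot_stdBasis]

/-- Convergence is absolute: the norm of each term is at most its trace, and the traces sum to Tr A.
-/
theorem hasSum_marginal (k : Fin n) {A : HTensor H →L[ℂ] HTensor H} (hA : 0 ≤ A)
    (ht : posTrace A ≠ ⊤) : HasSum (marginalTerm k A) (marginal k A) := by
  have hle : ∑' j, ‖marginalTerm k A j‖ₑ ≠ ⊤ := by
    refine ne_top_of_le_ne_top ht ?_
    rw [← tsum_posTrace_marginalTerm k hA]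
    exact ENNReal.tsum_le_tsum fun j => enorm_le_posTrace (marginalTerm_nonneg k hA j)
  have hs : Summable fun j => ‖marginalTerm k A j‖ := by
    simpa using ENNReal.summable_toReal hle
  exact hs.of_norm.hasSum

/-- No trace condition is needed, since a divergent `tsum` is 0 by default. -/
theorem marginal_nonneg (k : Fin n) {A : HTensor H →L[ℂ] HTensor H} (hA : 0 ≤ A) :
    0 ≤ marginal k A :=
  tsum_nonneg fun j => marginalTerm_nonneg k hA j

theorem marginal_mono (k : Fin n) {A B : HTensor H →L[ℂ] HTensor H} (hA : 0 ≤ A) (h : A ≤ B)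
    (ht : posTrace B ≠ ⊤) : marginal k A ≤ marginal k B :=
  hasSum_le (marginalTerm_mono k h)
    (hasSum_marginal k hA (ne_top_of_le_ne_top ht (posTrace_mono h)))
    (hasSum_marginal k (hA.trans h) ht)

theorem marginal_smul (k : Fin n) (c : ℝ) (A : HTensor H →L[ℂ] HTensor H) :
    marginal k (c • A) = c • marginal k A := by
  change ∑' j, marginalTerm k (c • A) j = c • ∑' j, marginalTerm k A j
  simp_rw [marginalTerm_smul]
  exact tsum_const_smul'' c

theorem posTrace_marginal (k : Fin n) {A : HTensor H →L[ℂ] HTensor H} (hA : 0 ≤ A)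
    (ht : posTrace A ≠ ⊤) : posTrace (marginal k A) = posTrace A := by
  rw [← tsum_posTrace_marginalTerm k hA]
  simp_rw [posTrace]
  rw [ENNReal.tsum_comm]
  refine tsum_congr fun a => ?_
  set x := stdBasis (H k) a
  have h1 : HasSum (fun j => RCLike.re ⟪x, marginalTerm k A j x⟫_ℂ)
      (RCLike.re ⟪x, marginal k A x⟫_ℂ) := by
    let L : (H k →L[ℂ] H k) →L[ℂ] ℂ := innerSL ℂ x ∘L ContinuousLinearMap.apply ℂ (H k) x
    exact RCLike.reCLM.hasSum (L.hasSum (hasSum_marginal k hA ht))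
  rw [← h1.tsum_eq, ENNReal.ofReal_tsum_of_nonneg
    (fun j => re_inner_nonneg_of_nonneg (marginalTerm_nonneg k hA j) x) h1.summable]

theorem marginal_mem_states (k : Fin n) {ρ : HTensor H →L[ℂ] HTensor H}
    (hρ : ρ ∈ states (HTensor H)) : marginal k ρ ∈ states (H k) :=
  ⟨marginal_nonneg k hρ.1, by rw [posTrace_marginal k hρ.1 (by simp [hρ.2]), hρ.2]⟩

theorem rank_marginal_le (k : Fin n) {A B : HTensor H →L[ℂ] HTensor H} (hA : 0 ≤ A)
    {c : ℝ} (hc : 0 < c) (h : c • A ≤ B) (ht : posTrace B ≠ ⊤) :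
    rank (marginal k A) ≤ rank (marginal k B) := by
  refine rank_le_of_smul_le (marginal_nonneg k hA) hc ?_
  rw [← marginal_smul]
  exact marginal_mono k (real_smul_nonneg hc.le hA) h ht

/-- Partial traces preserve order, and a dominated positive operator has the larger kernel. The
factor `c` is what lets normalized pieces of a state be compared with the state itself. -/
theorem dProd_le (m : ℕ) {A B : HTensor H →L[ℂ] HTensor H} (hA : 0 ≤ A)
    {c : ℝ} (hc : 0 < c) (h : c • A ≤ B) (ht : posTrace B ≠ ⊤) : dProd m A ≤ dProd m B :=
  Finset.prod_le_prod' fun k _ => rank_marginal_le k hA hc h ht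

theorem rank_ne_zero_of_mem_states {E : Type*} [NormedAddCommGroup E] [InnerProductSpace ℂ E]
    [CompleteSpace E] {ρ : E →L[ℂ] E} (hρ : ρ ∈ states E) : rank ρ ≠ 0 := by
  rw [ne_eq, rank_eq_zero_iff]
  rintro rfl
  simpa [posTrace] using hρ.2

theorem toNat_prod {ι : Type*} (s : Finset ι) (f : ι → ℕ∞) :
    (∏ i ∈ s, f i).toNat = ∏ i ∈ s, (f i).toNat :=
  map_prod ENat.toNatHom f s

/-- In `ℕ∞` an infinite factor could be hidden by a zero one; marginals of states are nonzero, so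
this does not happen. -/
theorem rank_marginal_ne_top {m : ℕ} {ρ : HTensor H →L[ℂ] HTensor H}
    (hρ : ρ ∈ states (HTensor H)) (hd : dProd m ρ ≠ ⊤) {k : Fin n} (hk : k ∈ firstSys n m) :
    rank (marginal k ρ) ≠ ⊤ := by
  classical
  intro h
  apply hd
  rw [dProd, ← Finset.mul_prod_erase _ _ hk, h, ENat.top_mul]
  exact Finset.prod_ne_zero_iff.mpr
    fun k _ => rank_ne_zero_of_mem_states (marginal_mem_states k hρ)

theorem Cm_le_log_dProd {m : ℕ} {ρ : HTensor H →L[ℂ] HTensor H}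
    (hρ : ρ ∈ states (HTensor H)) (hd : dProd m ρ ≠ ⊤) :
    Cm m ρ ≤ ENNReal.ofReal (Real.log (dProd m ρ).toNat) := by
  have hr := fun k (hk : k ∈ firstSys n m) => rank_marginal_ne_top hρ hd hk
  rw [dProd, toNat_prod, Nat.cast_prod, Real.log_prod, ENNReal.ofReal_sum_of_nonneg]
  · exact Finset.sum_le_sum fun k hk => entropy_le_log_rank (marginal_mem_states k hρ) (hr k hk)
  · exact fun k _ => Real.log_natCast_nonneg _
  · intro k hk
    rw [Nat.cast_ne_zero, ne_eq, ENat.toNat_eq_zero, not_or]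
    exact ⟨rank_ne_zero_of_mem_states (marginal_mem_states k hρ), hr k hk⟩

/-! ### The case of a single factor -/

theorem rank_conj_le {E F : Type*} [NormedAddCommGroup E] [InnerProductSpace ℂ E]
    [NormedAddCommGroup F] [InnerProductSpace ℂ F] (X : E →L[ℂ] F) (A : E →L[ℂ] E)
    (Y : F →L[ℂ] E) : rank (X ∘L A ∘L Y) ≤ rank A := by
  have h : LinearMap.range ((X ∘L A ∘L Y : F →L[ℂ] F) : F →ₗ[ℂ] F) ≤
      (LinearMap.range (A : E →ₗ[ℂ] E)).map (X : E →ₗ[ℂ] F) := by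
    rintro _ ⟨x, rfl⟩
    exact ⟨A (Y x), ⟨_, rfl⟩, rfl⟩
  have h2 := Cardinal.toENat.monotone'
    ((Cardinal.lift_le.mpr (Submodule.rank_mono h)).trans (lift_rank_map_le (X : E →ₗ[ℂ] F) _))
  exact (Cardinal.toENat_lift.symm.le.trans h2).trans Cardinal.toENat_lift.le

theorem subsingleton_restIdx (hn : n = 1) (k : Fin n) : Subsingleton (RestIdx H k) := by
  subst hn
  exact ⟨fun _ _ => funext fun l => (l.2 (Subsingleton.elim _ _)).elim⟩

theorem marginal_eq_marginalTerm (hn : n = 1) (k : Fin n) (j : RestIdx H k)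
    (A : HTensor H →L[ℂ] HTensor H) : marginal k A = marginalTerm k A j := by
  have := subsingleton_restIdx (H := H) hn k
  exact tsum_eq_single (f := marginalTerm k A) j fun i hi => (hi (Subsingleton.elim _ _)).elim

/-- For a single factor, tensoring is unitary. -/
theorem slot_adjoint_apply (hn : n = 1) (k : Fin n) (j : RestIdx H k) (y : HTensor H) :
    slot k j ((ContinuousLinearMap.adjoint (slot k j).toContinuousLinearMap) y) = y := by
  have hsub := subsingleton_restIdx (H := H) hn k
  set V := (slot k j).toContinuousLinearMap with hV
  have hVV : ∀ x, ContinuousLinearMap.adjoint V (V x) = x := fun x =>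
    ext_inner_left ℂ fun z => by
      rw [ContinuousLinearMap.adjoint_inner_right]
      exact (slot k j).inner_map_map z x
  rw [← sub_eq_zero]
  change V (ContinuousLinearMap.adjoint V y) - y = 0
  apply (prodBasis H).repr.injective
  ext i
  rw [HilbertBasis.repr_apply_apply, map_zero]
  have hi : prodBasis H i = V (stdBasis (H k) (i k)) := by
    change _ = slot k j _
    rw [slot_stdBasis]
    congr 1
    rw [Equiv.eq_symm_apply]
    exact Prod.ext rfl (Subsingleton.elim _ _)
  rw [hi, ← ContinuousLinearMap.adjoint_inner_right, map_sub, hVV, sub_self, inner_zero_right]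
  rfl

theorem rank_marginal_of_single (hn : n = 1) (k : Fin n) (A : HTensor H →L[ℂ] HTensor H)
    (j : RestIdx H k) : rank (marginal k A) = rank A := by
  rw [marginal_eq_marginalTerm hn k j]
  refine le_antisymm (rank_conj_le _ _ _) ?_
  have h : A = (slot k j).toContinuousLinearMap ∘L marginalTerm k A j ∘L
      ContinuousLinearMap.adjoint (slot k j).toContinuousLinearMap := by
    ext1 x
    change A x = slot k j ((ContinuousLinearMap.adjoint (slot k j).toContinuousLinearMap)
      (A (slot k j ((ContinuousLinearMap.adjoint (slot k j).toContinuousLinearMap) x))))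
    rw [slot_adjoint_apply hn, slot_adjoint_apply hn]
  conv_lhs => rw [h]
  exact rank_conj_le _ _ _

theorem dProd_of_single (hn : n = 1) {m : ℕ} (hm : m = 1) (A : HTensor H →L[ℂ] HTensor H) :
    dProd m A = rank A := by
  subst hn hm
  rw [dProd, show firstSys 1 1 = {0} from by decide, Finset.prod_singleton]
  exact rank_marginal_of_single rfl 0 A fun l => (l.2 (Subsingleton.elim _ _)).elim

end Marginals

/-! ### Supports and operators with orthogonal ranges -/

section Support

variable {E : Type*} [NormedAddCommGroup E] [InnerProductSpace ℂ E] [CompleteSpace E]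

theorem supp_eq_range {A : E →L[ℂ] E} (h : rank A ≠ ⊤) :
    supp A = LinearMap.range (A : E →ₗ[ℂ] E) := by
  have := finiteDimensional_range_of_rank_ne_top h
  exact (Submodule.closed_of_finiteDimensional _).submodule_topologicalClosure_eq

/-- Anything orthogonal to the range of B is killed by B, hence by A, hence orthogonal to the range
of A. Finite rank makes the range of B its own double orthogonal complement. -/
theorem range_le_range_of_le {A B : E →L[ℂ] E} (hA : 0 ≤ A) (h : A ≤ B) (hr : rank B ≠ ⊤) :
    LinearMap.range (A : E →ₗ[ℂ] E) ≤ LinearMap.range (B : E →ₗ[ℂ] E) := by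
  have := finiteDimensional_range_of_rank_ne_top hr
  rw [← Submodule.orthogonal_orthogonal (LinearMap.range (B : E →ₗ[ℂ] E))]
  rintro _ ⟨x, rfl⟩
  rw [Submodule.mem_orthogonal]
  intro y hy
  have hAy := apply_eq_zero_of_le hA h
    (apply_eq_zero_of_mem_orthogonal_range (hA.trans h) hy)
  change ⟪y, A x⟫_ℂ = 0
  rw [← inner_apply_comm hA, hAy, inner_zero_left]

theorem dStar_ne_top {ρ σ : E →L[ℂ] E} (hρ : rank ρ ≠ ⊤) (hσ : rank σ ≠ ⊤) :
    dStar ρ σ ≠ ⊤ := by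
  have := finiteDimensional_range_of_rank_ne_top hρ
  have := finiteDimensional_range_of_rank_ne_top hσ
  rw [dStar, supp_eq_range hρ, supp_eq_range hσ, ← Module.finrank_eq_rank, Cardinal.toENat_nat]
  exact ENat.natCast_ne_top _

/-- Two positive operators with orthogonal ranges dominated by `ρ` and `σ`. -/
theorem rank_add_rank_le_dStar {ρ σ A B : E →L[ℂ] E} (hρ : rank ρ ≠ ⊤) (hσ : rank σ ≠ ⊤)
    (hA : 0 ≤ A) (hB : 0 ≤ B) (hAρ : A ≤ ρ) (hBσ : B ≤ σ) (hAB : A * B = 0) :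
    rank A + rank B ≤ dStar ρ σ := by
  have := finiteDimensional_range_of_rank_ne_top hρ
  have := finiteDimensional_range_of_rank_ne_top hσ
  have hA' := range_le_range_of_le hA hAρ hρ
  have hB' := range_le_range_of_le hB hBσ hσ
  have := Submodule.finiteDimensional_of_le hA'
  have := Submodule.finiteDimensional_of_le hB'
  have hdisj : LinearMap.range (A : E →ₗ[ℂ] E) ⊓ LinearMap.range (B : E →ₗ[ℂ] E) = ⊥ := by
    refine (Submodule.IsOrtho.disjoint ?_).eq_bot
    rw [Submodule.isOrtho_iff_inner_eq]
    rintro _ ⟨x, rfl⟩ _ ⟨y, rfl⟩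
    change ⟪A x, B y⟫_ℂ = 0
    rw [inner_apply_comm hA, show A (B y) = 0 from congr($hAB y), inner_zero_right]
  have hdim := Submodule.finrank_sup_add_finrank_inf_eq (LinearMap.range (A : E →ₗ[ℂ] E))
    (LinearMap.range (B : E →ₗ[ℂ] E))
  rw [hdisj, finrank_bot, add_zero] at hdim
  rw [rank_eq_finrank rank_ne_top_of_finiteDimensional,
    rank_eq_finrank rank_ne_top_of_finiteDimensional, dStar, supp_eq_range hρ, supp_eq_range hσ,
    ← Module.finrank_eq_rank, Cardinal.toENat_nat, ← Nat.cast_add, ← hdim, Nat.cast_le]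
  exact Submodule.finrank_mono (sup_le_sup hA' hB')

end Support

/-! ### The decomposition of two commuting states -/

section Decomposition

variable {E : Type*} [NormedAddCommGroup E] [InnerProductSpace ℂ E] [CompleteSpace E]

theorem traceNorm_sub_comm (ρ σ : E →L[ℂ] E) : traceNorm (ρ - σ) = traceNorm (σ - ρ) := by
  rw [traceNorm, traceNorm, ← CFC.abs_neg, neg_sub]

theorem posTrace_posPart_sub {ρ σ : E →L[ℂ] E} (hρ : ρ ∈ states E) (hσ : σ ∈ states E) :
    posTrace (ρ - σ)⁺ = traceNorm (ρ - σ) / 2 ∧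
      posTrace (σ - ρ)⁺ = traceNorm (ρ - σ) / 2 := by
  have hs : IsSelfAdjoint (ρ - σ) := (IsSelfAdjoint.of_nonneg hρ.1).sub (.of_nonneg hσ.1)
  have h1 := CFC.posPart_add_negPart (ρ - σ) hs
  have h2 := CFC.posPart_sub_negPart (ρ - σ) hs
  rw [negPart_eq_posPart_sub_swap] at h1 h2
  have hp := CFC.posPart_nonneg (ρ - σ)
  have hq := CFC.posPart_nonneg (σ - ρ)
  have h3 : posTrace (ρ - σ)⁺ = posTrace (σ - ρ)⁺ := by
    -- `posTrace` is additive only on positive operators, so the subtraction is rewritten as an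
    -- equality of sums.
    have h4 : (ρ - σ)⁺ + σ = (σ - ρ)⁺ + ρ := by
      rw [add_comm (σ - ρ)⁺]
      exact sub_eq_sub_iff_add_eq_add.mp h2
    have h5 := congrArg posTrace h4
    rw [posTrace_add hp hσ.1, posTrace_add hq hρ.1, hρ.2, hσ.2] at h5
    exact (ENNReal.add_left_inj ENNReal.one_ne_top).mp h5
  have h6 : posTrace (ρ - σ)⁺ = traceNorm (ρ - σ) / 2 := by
    rw [traceNorm, ← h1, posTrace_add hp hq, ← h3, ← two_mul, mul_comm,
      ENNReal.mul_div_cancel_right two_ne_zero ENNReal.ofNat_ne_top]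
  exact ⟨h6, h3.symm.trans h6⟩

theorem traceNorm_sub_half_le_one {ρ σ : E →L[ℂ] E} (hρ : ρ ∈ states E) (hσ : σ ∈ states E)
    (hc : Commute ρ σ) : traceNorm (ρ - σ) / 2 ≤ 1 := by
  rw [← (posTrace_posPart_sub hρ hσ).1, ← hρ.2]
  exact posTrace_mono (posPart_sub_le hρ.1 hσ.1 hc)

theorem eq_of_traceNorm_sub_half_eq_zero {ρ σ : E →L[ℂ] E} (hρ : ρ ∈ states E)
    (hσ : σ ∈ states E) (h : traceNorm (ρ - σ) / 2 = 0) : ρ = σ := by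
  have hs : IsSelfAdjoint (ρ - σ) := (IsSelfAdjoint.of_nonneg hρ.1).sub (.of_nonneg hσ.1)
  obtain ⟨h1, h2⟩ := posTrace_posPart_sub hρ hσ
  have h3 := CFC.posPart_sub_negPart (ρ - σ) hs
  have hp := eq_zero_of_posTrace_eq_zero (CFC.posPart_nonneg (ρ - σ)) (h1.trans h)
  have hq := eq_zero_of_posTrace_eq_zero (CFC.posPart_nonneg (σ - ρ)) (h2.trans h)
  rw [negPart_eq_posPart_sub_swap, hp, hq, sub_zero] at h3
  exact sub_eq_zero.mp h3.symm

theorem smul_inv_mem_states {A : E →L[ℂ] E} (hA : 0 ≤ A) {ε : ℝ} (hε : 0 < ε)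
    (h : posTrace A = ENNReal.ofReal ε) : ε⁻¹ • A ∈ states E := by
  refine ⟨smul_nonneg (inv_pos.mpr hε).le hA, ?_⟩
  rw [posTrace_smul (inv_pos.mpr hε).le, h, ← ENNReal.ofReal_mul (inv_pos.mpr hε).le,
    inv_mul_cancel₀ hε.ne', ENNReal.ofReal_one]

/-- Two distinct commuting states are mixtures, with the same weights, of the normalized positive
and negative parts of their difference with a common state. -/
theorem exists_decomposition {S₀ : Set (E →L[ℂ] E)} (hS₀ : S₀ ⊆ states E)
    (hher : ∀ ϱ ∈ S₀, ∀ ς ∈ states E, (∃ c : ℝ, 0 < c ∧ c • ς ≤ ϱ) → Commute ϱ ς → ς ∈ S₀)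
    {ρ σ : E →L[ℂ] E} (hρ : ρ ∈ S₀) (hσ : σ ∈ S₀) (hc : Commute ρ σ) {ε : ℝ} (hε : 0 < ε)
    (h : traceNorm (ρ - σ) / 2 = ENNReal.ofReal ε) :
    ∃ τ ∈ S₀, ∃ τ' ∈ S₀, ∃ ω ∈ S₀, ε • τ = (ρ - σ)⁺ ∧ ε • τ' = (σ - ρ)⁺ ∧
      ρ = ε • τ + (1 - ε) • ω ∧ σ = ε • τ' + (1 - ε) • ω ∧ ∃ c : ℝ, 0 < c ∧ c • ω ≤ ρ := by
  have hρs := hS₀ hρ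
  have hσs := hS₀ hσ
  have hs : IsSelfAdjoint (ρ - σ) := (IsSelfAdjoint.of_nonneg hρs.1).sub (.of_nonneg hσs.1)
  obtain ⟨h1, h2⟩ := posTrace_posPart_sub hρs hσs
  have h3 := CFC.posPart_sub_negPart (ρ - σ) hs
  rw [negPart_eq_posPart_sub_swap] at h3
  have hp := CFC.posPart_nonneg (ρ - σ)
  have hq := CFC.posPart_nonneg (σ - ρ)
  have hpρ := posPart_sub_le hρs.1 hσs.1 hc
  have hqσ := posPart_sub_le hσs.1 hρs.1 hc.symm
  have hcp := commute_posPart_sub hc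
  have hcq := commute_posPart_sub hc.symm
  have hε1 : ε ≤ 1 := by
    have := traceNorm_sub_half_le_one hρs hσs hc
    rw [h, ← ENNReal.ofReal_one] at this
    exact (ENNReal.ofReal_le_ofReal_iff zero_le_one).mp this
  have hmp : ε • ε⁻¹ • (ρ - σ)⁺ = (ρ - σ)⁺ := smul_inv_smul₀ hε.ne' _
  have hmq : ε • ε⁻¹ • (σ - ρ)⁺ = (σ - ρ)⁺ := smul_inv_smul₀ hε.ne' _
  -- The common remainder of ρ and σ: the operator minimum of the two commuting states.
  have hrest : ρ - (ρ - σ)⁺ = σ - (σ - ρ)⁺ := by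
    rw [sub_eq_sub_iff_add_eq_add, add_comm σ]
    exact (sub_eq_sub_iff_add_eq_add.mp h3).symm
  have htr : posTrace (ρ - (ρ - σ)⁺) = ENNReal.ofReal (1 - ε) := by
    have := posTrace_add hp (sub_nonneg.mpr hpρ)
    rw [add_sub_cancel, hρs.2, h1, h, ← ENNReal.ofReal_one] at this
    rw [ENNReal.ofReal_sub _ hε.le, this, ENNReal.add_sub_cancel_left ENNReal.ofReal_ne_top]
  refine ⟨ε⁻¹ • (ρ - σ)⁺, hher ρ hρ _ (smul_inv_mem_states hp hε (h1.trans h))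
      ⟨ε, hε, hmp.trans_le hpρ⟩ (hcp.smul_right _),
    ε⁻¹ • (σ - ρ)⁺, hher σ hσ _ (smul_inv_mem_states hq hε (h2.trans h))
      ⟨ε, hε, hmq.trans_le hqσ⟩ (hcq.smul_right _), ?_⟩
  simp only [hmp, hmq, true_and]
  -- For ε = 1 the remainder vanishes and ω has weight 0, so any element of S₀ dominated by ρ
  -- serves; ρ itself is taken.
  rcases hε1.eq_or_lt with rfl | hlt
  · have h0 : ρ - (ρ - σ)⁺ = 0 :=
      eq_zero_of_posTrace_eq_zero (sub_nonneg.mpr hpρ) (by rw [htr]; simp)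
    refine ⟨ρ, hρ, ?_, ?_, 1, one_pos, (one_smul _ _).le⟩
    · rw [sub_self, zero_smul, add_zero]
      exact sub_eq_zero.mp h0
    · rw [sub_self, zero_smul, add_zero]
      exact sub_eq_zero.mp (hrest.symm.trans h0)
  · have hpos : 0 < 1 - ε := sub_pos.mpr hlt
    have hm : (1 - ε) • (1 - ε)⁻¹ • (ρ - (ρ - σ)⁺) = ρ - (ρ - σ)⁺ := smul_inv_smul₀ hpos.ne' _
    have hle : (1 - ε) • (1 - ε)⁻¹ • (ρ - (ρ - σ)⁺) ≤ ρ := by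
      rw [hm]
      exact sub_le_self _ hp
    refine ⟨(1 - ε)⁻¹ • (ρ - (ρ - σ)⁺),
      hher ρ hρ _ (smul_inv_mem_states (sub_nonneg.mpr hpρ) hpos htr) ⟨1 - ε, hpos, hle⟩
        (((Commute.refl ρ).sub_right hcp).smul_right _), ?_, ?_, 1 - ε, hpos, hle⟩
    · rw [hm, add_sub_cancel]
    · rw [hm, hrest, add_sub_cancel]

end Decomposition

/-! ### Estimates for the classes of functions -/

section Classes

/-- Nonemptiness of the family gives the upper bound for an infimum and the lower bound for a
supremum. -/
theorem hatClass_bounds {X : Type*} {S₀ : Set X} {L : Set (X → EReal)} {f : X → EReal}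
    (hf : f ∈ hatClass S₀ L) {x : X} (hx : x ∈ S₀) {lo hi : EReal}
    (h : ∀ g ∈ L, lo ≤ g x ∧ g x ≤ hi) : lo ≤ f x ∧ f x ≤ hi := by
  rcases hf with hf | ⟨F, hFL, ⟨g, hg⟩, hF | hF⟩
  · exact h f hf
  · rw [hF x hx]
    exact ⟨le_iInf₂ fun g hg => (h g (hFL hg)).1, (iInf₂_le g hg).trans (h g (hFL hg)).2⟩
  · rw [hF x hx]
    exact ⟨(h g (hFL hg)).1.trans (le_iSup₂ (f := fun (g : X → EReal) (_ : g ∈ F) => g x) g hg),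
      iSup₂_le fun g hg => (h g (hFL hg)).2⟩

/-- The constant `B` is common to the whole family. The additive one-sided form avoids differences
of infinite values. -/
theorem hatClass_le_add {X : Type*} {S₀ : Set X} {L : Set (X → EReal)} {f : X → EReal}
    (hf : f ∈ hatClass S₀ L) {x y : X} (hx : x ∈ S₀) (hy : y ∈ S₀) {B : ℝ}
    (h : ∀ g ∈ L, g x ≤ g y + (B : EReal)) : f x ≤ f y + (B : EReal) := by
  rcases hf with hf | ⟨F, hFL, -, hF | hF⟩
  · exact h f hf
  · rw [← EReal.sub_le_iff_le_add (.inl (EReal.coe_ne_bot B)) (.inl (EReal.coe_ne_top B)),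
      hF x hx, hF y hy]
    refine le_iInf₂ fun g hg => ?_
    rw [EReal.sub_le_iff_le_add (.inl (EReal.coe_ne_bot B)) (.inl (EReal.coe_ne_top B))]
    exact (iInf₂_le g hg).trans (h g (hFL hg))
  · rw [hF x hx, hF y hy]
    refine iSup₂_le fun g hg => (h g (hFL hg)).trans ?_
    gcongr
    exact le_iSup₂ (f := fun (g : X → EReal) (_ : g ∈ F) => g y) g hg

theorem hatClass_nonempty {X : Type*} {S₀ : Set X} {L : Set (X → EReal)} {f : X → EReal}
    (hf : f ∈ hatClass S₀ L) : L.Nonempty := by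
  rcases hf with hf | ⟨F, hFL, hF, -⟩
  · exact ⟨f, hf⟩
  · exact hF.mono hFL

theorem exists_coe_eq_of_bounds {x : EReal} {lo hi : ℝ} (h : (lo : EReal) ≤ x ∧ x ≤ hi) :
    ∃ a : ℝ, x = a := by
  refine ⟨x.toReal, (EReal.coe_toReal ?_ ?_).symm⟩
  · exact (h.2.trans_lt (EReal.coe_lt_top hi)).ne
  · exact ((EReal.bot_lt_coe lo).trans_le h.1).ne'

variable {n m : ℕ} {H : Fin n → Type*} [∀ k, NormedAddCommGroup (H k)]
  [∀ k, InnerProductSpace ℂ (H k)] [∀ k, CompleteSpace (H k)] {C D : ℝ}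
  {S₀ : Set (HTensor H →L[ℂ] HTensor H)} {f : (HTensor H →L[ℂ] HTensor H) → EReal}

theorem nonneg_of_mem_LClass (hf : f ∈ LClass m C D S₀) : 0 ≤ C ∧ 0 ≤ D := by
  obtain ⟨-, cm, cp, dm, dp, h1, h2, h3, h4, rfl, rfl, -⟩ := hf
  exact ⟨add_nonneg h1 h2, add_nonneg h3 h4⟩

theorem coe_mul_le_of_le_ofReal {c K : ℝ} (hc : 0 ≤ c) (hK : 0 ≤ K) {x : ℝ≥0∞}
    (h : x ≤ ENNReal.ofReal K) : (c : EReal) * (x : EReal) ≤ ((c * K : ℝ) : EReal) := by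
  have h1 : (x : EReal) ≤ (K : EReal) := by
    have := EReal.coe_ennreal_le_coe_ennreal_iff.mpr h
    rwa [EReal.coe_ennreal_ofReal, max_eq_left hK] at this
  rw [EReal.coe_mul]
  exact mul_le_mul_of_nonneg_left h1 (EReal.coe_nonneg.mpr hc)

theorem LClass_bounds (hf : f ∈ LClass m C D S₀) {ρ : HTensor H →L[ℂ] HTensor H}
    (hρ : ρ ∈ S₀) {K : ℝ} (hK : 0 ≤ K) (h : Cm m ρ ≤ ENNReal.ofReal K) :
    ((-(C * K) : ℝ) : EReal) ≤ f ρ ∧ f ρ ≤ ((C * K : ℝ) : EReal) := by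
  obtain ⟨-, cm, cp, dm, dp, h1, h2, h3, h4, rfl, rfl, hb, -⟩ := hf
  obtain ⟨hlo, hhi⟩ := hb ρ hρ
  constructor
  · refine le_trans ?_ hlo
    rw [EReal.coe_neg, EReal.neg_le_neg_iff]
    refine (coe_mul_le_of_le_ofReal h1 hK h).trans (EReal.coe_le_coe_iff.mpr ?_)
    nlinarith
  · refine hhi.trans ((coe_mul_le_of_le_ofReal h2 hK h).trans (EReal.coe_le_coe_iff.mpr ?_))
    nlinarith

theorem LClass_finite (hS₀ : S₀ ⊆ states (HTensor H)) (hf : f ∈ LClass m C D S₀)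
    {ρ : HTensor H →L[ℂ] HTensor H} (hρ : ρ ∈ S₀) (hd : dProd m ρ ≠ ⊤) :
    ((-(C * Real.log (dProd m ρ).toNat) : ℝ) : EReal) ≤ f ρ ∧
      f ρ ≤ ((C * Real.log (dProd m ρ).toNat : ℝ) : EReal) :=
  LClass_bounds hf hρ (Real.log_natCast_nonneg _) (Cm_le_log_dProd (hS₀ hρ) hd)

/-- The continuity estimate for a single function, in terms of a bound `K` for `C_m` on the
normalized positive and negative parts of `ρ - σ`. -/
theorem LClass_le_add (hS₀ : S₀ ⊆ states (HTensor H)) (hher : CommutingHereditary S₀)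
    (hf : f ∈ LClass m C D S₀) {ρ σ : HTensor H →L[ℂ] HTensor H} (hρ : ρ ∈ S₀) (hσ : σ ∈ S₀)
    (hc : Commute ρ σ) (hd : dProd m ρ ≠ ⊤) {ε : ℝ} (hε : 0 ≤ ε)
    (h : traceNorm (ρ - σ) / 2 = ENNReal.ofReal ε) {K : ℝ} (hK : 0 ≤ K)
    (hτ : 0 < ε → ∀ τ ∈ S₀, ∀ τ' ∈ S₀, ε • τ = opPos (ρ - σ) → ε • τ' = opPos (σ - ρ) →
      Cm m τ ≤ ENNReal.ofReal K ∧ (Cm m τ' ≤ ENNReal.ofReal K ∨ 0 ≤ f τ')) :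
    f ρ ≤ f σ + ((C * ε * K + D * Real.binEntropy ε : ℝ) : EReal) := by
  rcases hε.eq_or_lt with rfl | hε
  · rw [eq_of_traceNorm_sub_half_eq_zero (hS₀ hρ) (hS₀ hσ) (by simpa using h)]
    simp
  obtain ⟨τ, hτS, τ', hτS', ω, hωS, hp, hq, hρe, hσe, c, hcpos, hcω⟩ :=
    exists_decomposition hS₀ hher hρ hσ hc hε h
  have hε1 : ε ≤ 1 := by
    have := traceNorm_sub_half_le_one (hS₀ hρ) (hS₀ hσ) hc
    rw [h, ← ENNReal.ofReal_one] at this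
    exact (ENNReal.ofReal_le_ofReal_iff zero_le_one).mp this
  obtain ⟨hK1, hK2⟩ := hτ hε τ hτS τ' hτS' hp hq
  -- f(ω) is finite because ω is dominated by a multiple of ρ; without this it could not be
  -- cancelled.
  obtain ⟨w, hw⟩ := exists_coe_eq_of_bounds (LClass_finite hS₀ hf hωS
    (ne_top_of_le_ne_top hd (dProd_le m (hS₀ hωS).1 hcpos hcω (by simp [(hS₀ hρ).2]))))
  obtain ⟨-, cm, cp, dm, dp, h1, h2, h3, h4, rfl, rfl, hb, hmix⟩ := hf
  have hup : f τ ≤ ((cp * K : ℝ) : EReal) := (hb τ hτS).2.trans (coe_mul_le_of_le_ofReal h2 hK hK1)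
  -- If f(τ') ≥ 0, the lower bound -c⁻K is automatic and nothing about C_m(τ') is required.
  have hlow : ((-(cm * K) : ℝ) : EReal) ≤ f τ' := by
    rcases hK2 with hK2 | hK2
    · refine le_trans ?_ (hb τ' hτS').1
      rw [EReal.coe_neg, EReal.neg_le_neg_iff]
      exact coe_mul_le_of_le_ofReal h1 hK hK2
    · refine le_trans (EReal.coe_nonpos.mpr ?_) hK2
      nlinarith [mul_nonneg h1 hK]
  have hε0 : (0 : EReal) ≤ (ε : EReal) := EReal.coe_nonneg.mpr hε.le
  have hA : f ρ ≤ ((ε * (cp * K) + (1 - ε) * w + dp * Real.binEntropy ε : ℝ) : EReal) := by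
    have := (hmix τ hτS ω hωS ε ⟨hε.le, hε1⟩).2
    rw [hw] at this
    refine ((congrArg f hρe).trans_le this).trans ?_
    push_cast
    gcongr
    exact_mod_cast hup
  have hB : ((ε * (-(cm * K)) + (1 - ε) * w - dm * Real.binEntropy ε : ℝ) : EReal) ≤ f σ := by
    have := (hmix τ' hτS' ω hωS ε ⟨hε.le, hε1⟩).1
    rw [hw] at this
    refine le_trans ?_ (this.trans_eq (congrArg f hσe).symm)
    rw [EReal.coe_sub, EReal.coe_add, EReal.coe_mul, EReal.coe_mul (1 - ε)]
    refine EReal.sub_le_sub ?_ le_rfl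
    gcongr
  -- The terms (1-ε)f(ω) cancel, while c⁻ + c⁺ and d⁻ + d⁺ add up to the constants C and D.
  refine hA.trans (le_trans (le_of_eq ?_) (add_le_add_left hB _))
  rw [← EReal.coe_add]
  congr 1
  ring

end Classes

/-! ### Elementary properties of the bounds -/

section Bounds

/-- A real `sSup` dominates its members only for bounded sets; here continuity on [0, ε] supplies
boundedness. -/
theorem bnd_le_upEnv (C D d : ℝ) {t ε : ℝ} (ht : 0 ≤ t) (h : t ≤ ε) :
    bnd C D d t ≤ upEnv (bnd C D d) ε := by
  refine le_csSup ?_ ⟨t, ⟨ht, h⟩, rfl⟩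
  refine (isCompact_Icc.image_of_continuousOn ?_).bddAbove
  unfold bnd
  have := Real.binEntropy_continuous
  fun_prop

theorem binEntropy_le_hUp {t ε : ℝ} (ht : 0 ≤ t) (h : t ≤ ε) : Real.binEntropy t ≤ hUp ε := by
  unfold hUp
  split_ifs with hε
  · refine Real.binEntropy_strictMonoOn.monotoneOn ?_ ?_ h <;> constructor <;> norm_num at * <;>
      linarith
  · exact Real.binEntropy_le_log_two

theorem bnd_le_bndUp {C D d : ℝ} (hC : 0 ≤ C) (hD : 0 ≤ D) (hd : 0 ≤ Real.log d) {t ε : ℝ}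
    (ht : 0 ≤ t) (h : t ≤ ε) : bnd C D d t ≤ bndUp C D d ε := by
  have := binEntropy_le_hUp ht h
  unfold bnd bndUp
  gcongr

/-- The cases N = 0 and N = 1 rest on the values `Real.log (-1) = 0` and `Real.log 0 = 0`. -/
theorem log_natCast_sub_one_nonneg (N : ℕ) : 0 ≤ Real.log ((N : ℝ) - 1) := by
  rcases N with _ | N
  · simp
  · rw [Nat.cast_succ, add_sub_cancel_right]
    exact Real.log_natCast_nonneg N

theorem log_natCast_mono {a b : ℕ} (h : a ≤ b) : Real.log a ≤ Real.log b := by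
  rcases Nat.eq_zero_or_pos a with rfl | ha
  · simpa using Real.log_natCast_nonneg b
  · exact Real.log_le_log (by exact_mod_cast ha) (by exact_mod_cast h)

end Bounds

/-! ### The continuity bounds -/

section Main

variable {n m : ℕ} {H : Fin n → Type*} [∀ k, NormedAddCommGroup (H k)]
  [∀ k, InnerProductSpace ℂ (H k)] [∀ k, CompleteSpace (H k)] {C D : ℝ}
  {S₀ : Set (HTensor H →L[ℂ] HTensor H)} {f : (HTensor H →L[ℂ] HTensor H) → EReal}
  {ρ σ τ τ' : HTensor H →L[ℂ] HTensor H} {ε : ℝ}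

theorem dStar_comm {E : Type*} [NormedAddCommGroup E] [InnerProductSpace ℂ E] [CompleteSpace E]
    (ρ σ : E →L[ℂ] E) : dStar ρ σ = dStar σ ρ := by
  rw [dStar, dStar, sup_comm]

theorem dMax_comm (m : ℕ) (ρ σ : HTensor H →L[ℂ] HTensor H) : dMax m ρ σ = dMax m σ ρ :=
  max_comm _ _

theorem Cm_le_log_of_dProd_le (hτ : τ ∈ states (HTensor H)) {d : ℕ∞} (h : dProd m τ ≤ d)
    (hd : d ≠ ⊤) : Cm m τ ≤ ENNReal.ofReal (Real.log d.toNat) :=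
  (Cm_le_log_dProd hτ (ne_top_of_le_ne_top hd h)).trans
    (ENNReal.ofReal_le_ofReal (log_natCast_mono (ENat.toNat_le_toNat h hd)))

theorem dProd_le_of_smul_eq_opPos (hρ : ρ ∈ states (HTensor H)) (hσ : σ ∈ states (HTensor H))
    (hc : Commute ρ σ) (hε : 0 < ε) (hτ : τ ∈ states (HTensor H)) (h : ε • τ = opPos (ρ - σ)) :
    dProd m τ ≤ dProd m ρ :=
  dProd_le m hτ.1 hε (h.trans_le (posPart_sub_le hρ.1 hσ.1 hc)) (by simp [hρ.2])

theorem posTrace_opPos_sub_ne_top (hρ : ρ ∈ states (HTensor H)) (hσ : σ ∈ states (HTensor H))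
    (hc : Commute ρ σ) : posTrace (opPos (ρ - σ)) ≠ ⊤ :=
  ne_top_of_le_ne_top (by simp [hρ.2]) (posTrace_mono (posPart_sub_le hρ.1 hσ.1 hc))

theorem opPos_nonneg {E : Type*} [NormedAddCommGroup E] [InnerProductSpace ℂ E] [CompleteSpace E]
    (A : E →L[ℂ] E) : 0 ≤ opPos A :=
  CFC.posPart_nonneg A

theorem dPlus_le_dProd (hρ : ρ ∈ states (HTensor H)) (hσ : σ ∈ states (HTensor H))
    (hc : Commute ρ σ) : dPlus m ρ σ ≤ dProd m ρ :=
  dProd_le m (opPos_nonneg _) one_pos ((one_smul ℝ _).trans_le (posPart_sub_le hρ.1 hσ.1 hc))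
    (by simp [hρ.2])

theorem dProd_le_dPlus_of_smul_eq_opPos (hρ : ρ ∈ states (HTensor H))
    (hσ : σ ∈ states (HTensor H)) (hc : Commute ρ σ) (hε : 0 < ε) (hτ : τ ∈ states (HTensor H))
    (h : ε • τ = opPos (ρ - σ)) : dProd m τ ≤ dPlus m ρ σ :=
  dProd_le m hτ.1 hε h.le (posTrace_opPos_sub_ne_top hρ hσ hc)

theorem rank_le_of_smul_eq_opPos {E : Type*} [NormedAddCommGroup E] [InnerProductSpace ℂ E]
    [CompleteSpace E] {A τ : E →L[ℂ] E} (hε : 0 < ε) (hτ : τ ∈ states E)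
    (h : ε • τ = opPos A) : rank τ ≤ rank (opPos A) :=
  rank_le_of_smul_le hτ.1 hε h.le

/-- The positive and negative parts of ρ - σ have product zero, hence orthogonal ranges, and they
lie below ρ and σ respectively. -/
theorem rank_add_rank_le_dStar_of_smul_eq_opPos {E : Type*} [NormedAddCommGroup E]
    [InnerProductSpace ℂ E] [CompleteSpace E] {ρ σ τ τ' : E →L[ℂ] E} (hρ : ρ ∈ states E)
    (hσ : σ ∈ states E) (hc : Commute ρ σ) (hrρ : rank ρ ≠ ⊤) (hrσ : rank σ ≠ ⊤) (hε : 0 < ε)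
    (hτ : τ ∈ states E) (hτ' : τ' ∈ states E) (h : ε • τ = opPos (ρ - σ))
    (h' : ε • τ' = opPos (σ - ρ)) : rank τ + rank τ' ≤ dStar ρ σ := by
  refine (add_le_add (rank_le_of_smul_eq_opPos hε hτ h)
    (rank_le_of_smul_eq_opPos hε hτ' h')).trans ?_
  refine rank_add_rank_le_dStar hrρ hrσ (opPos_nonneg _) (opPos_nonneg _)
    (posPart_sub_le hρ.1 hσ.1 hc) (posPart_sub_le hσ.1 hρ.1 hc.symm) ?_
  have := CFC.posPart_mul_negPart (ρ - σ)
  rwa [negPart_eq_posPart_sub_swap] at this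

/-- If the rank of `τ` plus that of another state is at most `d`, then `C_1(τ) ≤ ln (d - 1)`. -/
theorem Cm_le_log_sub_one (hn : n = 1) (hm : m = 1) (hτ : τ ∈ states (HTensor H))
    (hτ' : τ' ∈ states (HTensor H)) {d : ℕ∞} (h : rank τ + rank τ' ≤ d) (hd : d ≠ ⊤) :
    Cm m τ ≤ ENNReal.ofReal (Real.log ((d.toNat : ℝ) - 1)) := by
  -- The state τ' has rank at least 1: this is the source of the -1.
  have h1 : rank τ + 1 ≤ d :=
    (add_le_add_right (Order.one_le_iff_pos.mpr
      (pos_iff_ne_zero.mpr (rank_ne_zero_of_mem_states hτ'))) _).trans h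
  have hr : rank τ ≠ ⊤ := ne_top_of_le_ne_top hd (le_self_add.trans h1)
  have h2 := ENat.toNat_le_toNat h1 hd
  rw [ENat.toNat_add hr ENat.one_ne_top, ENat.toNat_one] at h2
  rw [← dProd_of_single hn hm] at hr h2
  refine (Cm_le_log_dProd hτ hr).trans (ENNReal.ofReal_le_ofReal ?_)
  have h3 : (d.toNat : ℝ) - 1 = ((d.toNat - 1 : ℕ) : ℝ) := by
    rw [Nat.cast_sub (by omega), Nat.cast_one]
  rw [h3]
  exact log_natCast_mono (by omega)

/-- One-sided form of the bound in terms of `d_m(ρ, σ)`. -/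
theorem LHat_le_add_dMax (hS₀ : S₀ ⊆ states (HTensor H)) (hher : CommutingHereditary S₀)
    (hf : f ∈ LHat m C D S₀) (hρ : ρ ∈ S₀) (hσ : σ ∈ S₀) (hc : Commute ρ σ)
    (hd : dMax m ρ σ ≠ ⊤) (hε : 0 ≤ ε) (h : traceNorm (ρ - σ) / 2 = ENNReal.ofReal ε) :
    f ρ ≤ f σ + (bnd C D ((dMax m ρ σ).toNat : ℝ) ε : EReal) := by
  refine hatClass_le_add hf hρ hσ fun g hg => LClass_le_add hS₀ hher hg hρ hσ hc
    (ne_top_of_le_ne_top hd (le_max_left _ _)) hε h (Real.log_natCast_nonneg _) ?_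
  intro hε τ hτ τ' hτ' hp hq
  exact ⟨Cm_le_log_of_dProd_le (hS₀ hτ) ((dProd_le_of_smul_eq_opPos (hS₀ hρ) (hS₀ hσ) hc hε
      (hS₀ hτ) hp).trans (le_max_left _ _)) hd,
    .inl (Cm_le_log_of_dProd_le (hS₀ hτ') ((dProd_le_of_smul_eq_opPos (hS₀ hσ) (hS₀ hρ) hc.symm hε
      (hS₀ hτ') hq).trans (le_max_right _ _)) hd)⟩

/-- One-sided form of the bound in terms of `d_*(ρ, σ)`. -/
theorem LHat_le_add_dStar (hn : n = 1) (hm : m = 1) (hS₀ : S₀ ⊆ states (HTensor H))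
    (hher : CommutingHereditary S₀)
    (hf : f ∈ LHat m C D S₀) (hρ : ρ ∈ S₀) (hσ : σ ∈ S₀) (hc : Commute ρ σ)
    (hrρ : rank ρ ≠ ⊤) (hrσ : rank σ ≠ ⊤) (hε : 0 ≤ ε)
    (h : traceNorm (ρ - σ) / 2 = ENNReal.ofReal ε) :
    f ρ ≤ f σ + (bnd C D (((dStar ρ σ).toNat : ℝ) - 1) ε : EReal) := by
  refine hatClass_le_add hf hρ hσ fun g hg => LClass_le_add hS₀ hher hg hρ hσ hc
    (by rwa [dProd_of_single hn hm]) hε h (log_natCast_sub_one_nonneg _) ?_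
  intro hε τ hτ τ' hτ' hp hq
  have hle := rank_add_rank_le_dStar_of_smul_eq_opPos (hS₀ hρ) (hS₀ hσ) hc hrρ hrσ hε
    (hS₀ hτ) (hS₀ hτ') hp hq
  exact ⟨Cm_le_log_sub_one hn hm (hS₀ hτ) (hS₀ hτ') hle (dStar_ne_top hrρ hrσ),
    .inl (Cm_le_log_sub_one hn hm (hS₀ hτ') (hS₀ hτ) ((add_comm _ _).trans_le hle)
      (dStar_ne_top hrρ hrσ))⟩

/-- The bound for nonnegative functions in terms of `d_m^*(ρ, σ)`. -/
theorem LHatNonneg_le_add_dPlus (hS₀ : S₀ ⊆ states (HTensor H)) (hher : CommutingHereditary S₀)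
    (hf : f ∈ LHatNonneg m C D S₀) (hρ : ρ ∈ S₀) (hσ : σ ∈ S₀) (hc : Commute ρ σ)
    (hd : dProd m ρ ≠ ⊤) (hε : 0 ≤ ε) (h : traceNorm (ρ - σ) / 2 = ENNReal.ofReal ε) :
    f ρ ≤ f σ + (bnd C D ((dPlus m ρ σ).toNat : ℝ) ε : EReal) := by
  refine hatClass_le_add hf hρ hσ fun g hg => LClass_le_add hS₀ hher hg.1 hρ hσ hc
    hd hε h (Real.log_natCast_nonneg _) ?_
  intro hε τ hτ τ' hτ' hp _
  exact ⟨Cm_le_log_of_dProd_le (hS₀ hτ) (dProd_le_dPlus_of_smul_eq_opPos (hS₀ hρ) (hS₀ hσ) hc hε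
      (hS₀ hτ) hp) (ne_top_of_le_ne_top hd (dPlus_le_dProd (hS₀ hρ) (hS₀ hσ) hc)),
    .inr (hg.2 τ' hτ')⟩

theorem bnd_mono_natCast {a b : ℕ} (hab : a ≤ b) (hC : 0 ≤ C) (D : ℝ) (hε : 0 ≤ ε) :
    bnd C D a ε ≤ bnd C D b ε := by
  have := log_natCast_mono hab
  unfold bnd
  gcongr

theorem abs_sub_le_of_coe_le {a b B : ℝ} (h1 : (a : EReal) ≤ b + (B : EReal))
    (h2 : (b : EReal) ≤ a + (B : EReal)) : |a - b| ≤ B := by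
  have h1' : a ≤ b + B := by exact_mod_cast h1
  have h2' : b ≤ a + B := by exact_mod_cast h2
  exact abs_sub_le_iff.mpr ⟨by linarith, by linarith⟩

theorem sub_le_of_le_add_coe {x y : EReal} {B B' : ℝ} (h : x ≤ y + (B : EReal)) (hB : B ≤ B') :
    x - y ≤ (B' : EReal) := by
  refine le_trans (EReal.sub_le_of_le_add ?_) (EReal.coe_le_coe_iff.mpr hB)
  rwa [add_comm]

theorem exists_ofReal_eq_of_le {x : ℝ≥0∞} (h : x ≤ ENNReal.ofReal ε) (hε : 0 ≤ ε) :
    ∃ t : ℝ, 0 ≤ t ∧ t ≤ ε ∧ x = ENNReal.ofReal t :=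
  ⟨x.toReal, ENNReal.toReal_nonneg, ENNReal.toReal_le_of_le_ofReal hε h,
    (ENNReal.ofReal_toReal (ne_top_of_le_ne_top ENNReal.ofReal_ne_top h)).symm⟩

end Main

end QState

end

theorem corollary1 {n m : ℕ} (hmn : m ≤ n) (H : Fin n → Type*)
    [∀ k, NormedAddCommGroup (H k)] [∀ k, InnerProductSpace ℂ (H k)] [∀ k, CompleteSpace (H k)]
    [∀ k, TopologicalSpace.SeparableSpace (H k)] (C D : ℝ)
    (S₀ : Set (QState.HTensor H →L[ℂ] QState.HTensor H))
    (hS₀ : S₀ ⊆ QState.states (QState.HTensor H)) (hconv : Convex ℝ S₀)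
    (hher : QState.CommutingHereditary S₀) :
    -- Part A
    (∀ f ∈ QState.LHat m C D S₀, ∀ ρ ∈ S₀, ∀ σ ∈ S₀, QState.dMax m ρ σ ≠ ⊤ → Commute ρ σ →
      ∃ a b : ℝ, f ρ = (a : EReal) ∧ f σ = (b : EReal) ∧
        (m = 1 → n = 1 → QState.dStar ρ σ ≠ ⊤) ∧
        (∀ ε : ℝ, 0 ≤ ε → QState.traceNorm (ρ - σ) / 2 = ENNReal.ofReal ε →
          |a - b| ≤ QState.bnd C D ((QState.dMax m ρ σ).toNat : ℝ) ε ∧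
          (m = 1 → n = 1 →
            |a - b| ≤ QState.bnd C D (((QState.dStar ρ σ).toNat : ℝ) - 1) ε)) ∧
        (∀ ε ∈ Set.Icc (0 : ℝ) 1, QState.traceNorm (ρ - σ) / 2 ≤ ENNReal.ofReal ε →
          |a - b| ≤ QState.upEnv (QState.bnd C D ((QState.dMax m ρ σ).toNat : ℝ)) ε ∧
          |a - b| ≤ QState.bndUp C D ((QState.dMax m ρ σ).toNat : ℝ) ε ∧
          (m = 1 → n = 1 →
            |a - b| ≤ QState.upEnv (QState.bnd C D (((QState.dStar ρ σ).toNat : ℝ) - 1)) ε ∧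
            |a - b| ≤ QState.bndUp C D (((QState.dStar ρ σ).toNat : ℝ) - 1) ε))) ∧
    -- Part B
    (∀ f ∈ QState.LHatNonneg m C D S₀, ∀ ρ ∈ S₀, QState.dProd m ρ ≠ ⊤ →
      ∀ σ ∈ S₀, Commute ρ σ →
        ∃ a : ℝ, f ρ = (a : EReal) ∧ QState.dPlus m ρ σ ≠ ⊤ ∧
          (∀ ε : ℝ, 0 ≤ ε → QState.traceNorm (ρ - σ) / 2 = ENNReal.ofReal ε →
            (a : EReal) - f σ ≤ (QState.bnd C D ((QState.dProd m ρ).toNat : ℝ) ε : ℝ) ∧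
            (a : EReal) - f σ ≤
              (QState.bnd C D ((QState.dPlus m ρ σ).toNat : ℝ) ε : ℝ)) ∧
          (∀ ε ∈ Set.Icc (0 : ℝ) 1, QState.traceNorm (ρ - σ) / 2 ≤ ENNReal.ofReal ε →
            (a : EReal) - f σ ≤
              (QState.upEnv (QState.bnd C D ((QState.dProd m ρ).toNat : ℝ)) ε : ℝ) ∧
            (a : EReal) - f σ ≤ (QState.bndUp C D ((QState.dProd m ρ).toNat : ℝ) ε : ℝ) ∧
            (a : EReal) - f σ ≤
              (QState.upEnv (QState.bnd C D ((QState.dPlus m ρ σ).toNat : ℝ)) ε : ℝ) ∧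
            (a : EReal) - f σ ≤
              (QState.bndUp C D ((QState.dPlus m ρ σ).toNat : ℝ) ε : ℝ))) := by
  refine ⟨fun f hf ρ hρ σ hσ hd hc => ?_, fun f hf ρ hρ hd σ hσ hc => ?_⟩
  · obtain ⟨g₀, hg₀⟩ := QState.hatClass_nonempty hf
    obtain ⟨hC, hD⟩ := QState.nonneg_of_mem_LClass hg₀
    have hdρ : QState.dProd m ρ ≠ ⊤ := ne_top_of_le_ne_top hd (le_max_left _ _)
    have hdσ : QState.dProd m σ ≠ ⊤ := ne_top_of_le_ne_top hd (le_max_right _ _)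
    obtain ⟨a, ha⟩ := QState.exists_coe_eq_of_bounds
      (QState.hatClass_bounds hf hρ fun g hg => QState.LClass_finite hS₀ hg hρ hdρ)
    obtain ⟨b, hb⟩ := QState.exists_coe_eq_of_bounds
      (QState.hatClass_bounds hf hσ fun g hg => QState.LClass_finite hS₀ hg hσ hdσ)
    have hmain : ∀ ε : ℝ, 0 ≤ ε → QState.traceNorm (ρ - σ) / 2 = ENNReal.ofReal ε →
        |a - b| ≤ QState.bnd C D ((QState.dMax m ρ σ).toNat : ℝ) ε ∧
        (m = 1 → n = 1 →
          |a - b| ≤ QState.bnd C D (((QState.dStar ρ σ).toNat : ℝ) - 1) ε) := by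
      intro ε hε h
      have h' := h
      rw [QState.traceNorm_sub_comm] at h'
      -- Each two-sided bound is the one-sided one applied to (ρ, σ) and to (σ, ρ), the dimension
      -- being symmetric.
      refine ⟨QState.abs_sub_le_of_coe_le ?_ ?_, fun hm hn => ?_⟩
      · rw [← ha, ← hb]
        exact QState.LHat_le_add_dMax hS₀ hher hf hρ hσ hc hd hε h
      · rw [← ha, ← hb, QState.dMax_comm]
        rw [QState.dMax_comm] at hd
        exact QState.LHat_le_add_dMax hS₀ hher hf hσ hρ hc.symm hd hε h'
      · rw [QState.dProd_of_single hn hm] at hdρ hdσ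
        refine QState.abs_sub_le_of_coe_le ?_ ?_
        · rw [← ha, ← hb]
          exact QState.LHat_le_add_dStar hn hm hS₀ hher hf hρ hσ hc hdρ hdσ hε h
        · rw [← ha, ← hb, QState.dStar_comm]
          exact QState.LHat_le_add_dStar hn hm hS₀ hher hf hσ hρ hc.symm hdσ hdρ hε h'
    refine ⟨a, b, ha, hb, fun hm hn => ?_, hmain, fun ε hε h => ?_⟩
    · rw [QState.dProd_of_single hn hm] at hdρ hdσ
      exact QState.dStar_ne_top hdρ hdσ
    -- The exact bound is applied at the true distance t ≤ ε and then enlarged to its envelopes.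
    · obtain ⟨t, ht, htε, hteq⟩ := QState.exists_ofReal_eq_of_le h hε.1
      obtain ⟨h1, h2⟩ := hmain t ht hteq
      exact ⟨h1.trans (QState.bnd_le_upEnv C D _ ht htε),
        h1.trans (QState.bnd_le_bndUp hC hD (Real.log_natCast_nonneg _) ht htε),
        fun hm hn => ⟨(h2 hm hn).trans (QState.bnd_le_upEnv C D _ ht htε),
          (h2 hm hn).trans
            (QState.bnd_le_bndUp hC hD (QState.log_natCast_sub_one_nonneg _) ht htε)⟩⟩
  · obtain ⟨g₀, hg₀⟩ := QState.hatClass_nonempty hf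
    obtain ⟨hC, hD⟩ := QState.nonneg_of_mem_LClass hg₀.1
    obtain ⟨a, ha⟩ := QState.exists_coe_eq_of_bounds
      (QState.hatClass_bounds hf hρ fun g hg => QState.LClass_finite hS₀ hg.1 hρ hd)
    -- Since d_m^* ≤ d_m(ρ), the bounds with d_m(ρ) follow from those with d_m^*.
    have hle := QState.dPlus_le_dProd (m := m) (hS₀ hρ) (hS₀ hσ) hc
    have hle' := ENat.toNat_le_toNat hle hd
    have hmain := fun (ε : ℝ) (hε : 0 ≤ ε) h =>
      QState.LHatNonneg_le_add_dPlus (ε := ε) hS₀ hher hf hρ hσ hc hd hε h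
    simp only [ha] at hmain
    refine ⟨a, ha, ne_top_of_le_ne_top hd hle, fun ε hε h => ?_, fun ε hε h => ?_⟩
    · exact ⟨QState.sub_le_of_le_add_coe (hmain ε hε h) (QState.bnd_mono_natCast hle' hC D hε),
        QState.sub_le_of_le_add_coe (hmain ε hε h) le_rfl⟩
    · obtain ⟨t, ht, htε, hteq⟩ := QState.exists_ofReal_eq_of_le h hε.1
      have h1 := hmain t ht hteq
      have h2 := QState.bnd_mono_natCast hle' hC D ht
      exact ⟨QState.sub_le_of_le_add_coe h1 (h2.trans (QState.bnd_le_upEnv C D _ ht htε)),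
        QState.sub_le_of_le_add_coe h1
          (h2.trans (QState.bnd_le_bndUp hC hD (Real.log_natCast_nonneg _) ht htε)),
        QState.sub_le_of_le_add_coe h1 (QState.bnd_le_upEnv C D _ ht htε),
        QState.sub_le_of_le_add_coe h1
          (QState.bnd_le_bndUp hC hD (Real.log_natCast_nonneg _) ht htε)⟩
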